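/- Let $L>0$, $0<n_-<n_+$ and $\rho>0$. Let $\mathcal A_{sym}$ be the set of measurable $n:\mathbb R\to\mathbb R$ with $n_-\le n\le n_+$ on $[0,L]$, $n=1$ off $[0,L]$ and $n(x)=n(L-x)$ (all up to null sets). A number $\omega\in\mathbb C$ is a scattering resonance of $n$, $\omega\in\mathrm{Res}_n$, if there is a nontrivial $u\in L^1_{\rm loc}(\mathbb R;\mathbb C)$ with $$u(x)=\omega^2\int_0^L G(|x-y|,\omega)\,[n^2(y)-1]\,u(y)\,dy\quad\text{for a.e. } x\in\mathbb R,\qquad G(r,\omega)=-\frac{1}{2i\omega}e^{i\omega r}$$ (the right-hand side being read as $0$ for $\omega=0$, so that $0\notin\mathrm{Res}_n$), and $\Gamma^\rho[n]:=\inf\{|\Im\omega| : \omega\in\mathrm{Res}_n,\ |\Re\omega|\le\rho\}$, with $\inf\emptyset=\infty$. Let $n_\star\in\mathcal A_{sym}$ be a local minimizer, with respect to the $L^\infty$ distance, of $\Gamma^\rho$ over $\mathcal A_{sym}$ (for instance a global minimizer), and suppose that $\Gamma^\rho[n_\star]=|\Im\omega_\star|$ for some $\omega_\star\in\mathrm{Res}_{n_\star}$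 with $0<|\Re\omega_\star|<\rho$. Then $n_\star$ has only finitely many transition points between $n_+$ and $n_-$, that is, points $x\in[0,L]$ every neighbourhood of which in $[0,L]$ contains both a subset of positive measure on which $n_\star=n_+$ and one on which $n_\star=n_-$. Moreover $n_\star$ is a step function: there are $0=x_0<x_1<\dots<x_N=L$ such that, for each $j$, either $n_\star=n_+$ a.e. on $(x_j,x_{j+1})$ or $n_\star=n_-$ a.e. on $(x_j,x_{j+1})$. -/

import Mathlib

open MeasureTheory

noncomputable section

namespace ScatRes

/-- The outgoing free-space Green's function of `-d²/dx² - ω²` on the line, as a function of the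
distance `r = |x - y|`: `G(r, ω) = -(2iω)⁻¹ exp(iωr)`. -/
def green (r : ℝ) (ω : ℂ) : ℂ :=
  -(2 * Complex.I * ω)⁻¹ * Complex.exp (Complex.I * ω * (r : ℂ))

/-- `(ω, u)` is a scattering resonance pair of the index `n` on `[0, L]`: `u` is a nontrivial
locally integrable solution of
`u(x) = ω² ∫_{[0,L]} G(|x - y|, ω) (n(y)² - 1) u(y) dy`.
For `ω = 0` the right-hand side is `0`, so `0` is never a resonance. -/
structure IsResonancePair (L : ℝ) (n : ℝ → ℝ) (ω : ℂ) (u : ℝ → ℂ) : Prop where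
  locallyIntegrable : LocallyIntegrable u volume
  nontrivial : ¬ (u =ᵐ[volume] 0)
  equation : ∀ᵐ x : ℝ, u x =
    ω ^ 2 * ∫ y in Set.Icc 0 L, green |x - y| ω * ((n y : ℂ) ^ 2 - 1) * u y

/-- The set of scattering resonances of the index `n`. -/
def Res (L : ℝ) (n : ℝ → ℝ) : Set ℂ :=
  {ω | ∃ u : ℝ → ℂ, IsResonancePair L n ω u}

/-- The scattering resonances `ω` of `n` with `|Re ω| ≤ ρ`. -/
def ResBelow (L ρ : ℝ) (n : ℝ → ℝ) : Set ℂ :=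
  {ω | ω ∈ Res L n ∧ |ω.re| ≤ ρ}

/-- The minimal resonance width `Γ^ρ[n] = inf {|Im ω| : ω ∈ Res_n, |Re ω| ≤ ρ}`,
equal to `∞` if there is no such resonance. -/
def width (L ρ : ℝ) (n : ℝ → ℝ) : ENNReal :=
  ⨅ ω ∈ ResBelow L ρ n, ENNReal.ofReal |ω.im|

/-- The admissible indices: measurable, `n = 1` off `[0, L]`, and `n₋ ≤ n ≤ n₊` on `[0, L]`
(as for elements of `L^∞`, up to null sets). -/
def Admissible (L nminus nplus : ℝ) : Set (ℝ → ℝ) :=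
  {n | AEMeasurable n volume ∧
    (∀ᵐ x : ℝ, x ∉ Set.Icc 0 L → n x = 1) ∧
    (∀ᵐ x : ℝ, x ∈ Set.Icc 0 L → nminus ≤ n x ∧ n x ≤ nplus)}

/-- The admissible indices that are symmetric about `L / 2`. -/
def AdmissibleSym (L nminus nplus : ℝ) : Set (ℝ → ℝ) :=
  {n | n ∈ Admissible L nminus nplus ∧ ∀ᵐ x : ℝ, n x = n (L - x)}

/-- `n` minimizes `Γ^ρ` among the symmetric admissible indices in some `L^∞`-ball around `n`.
In particular every global minimizer over the symmetric admissible indices is one. -/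
def IsLocallyOptimal (L nminus nplus ρ : ℝ) (n : ℝ → ℝ) : Prop :=
  n ∈ AdmissibleSym L nminus nplus ∧
  ∃ δ : ℝ, 0 < δ ∧ ∀ m ∈ AdmissibleSym L nminus nplus,
    eLpNorm (fun x => m x - n x) ⊤ volume < ENNReal.ofReal δ → width L ρ n ≤ width L ρ m

/-- `x ∈ [0, L]` is a transition point of `n` between `n₊` and `n₋`: in every neighbourhood of `x`
in `[0, L]`, both values are taken on sets of positive measure. -/
def IsTransitionPoint (L nminus nplus : ℝ) (n : ℝ → ℝ) (x : ℝ) : Prop :=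
  x ∈ Set.Icc 0 L ∧ ∀ ε : ℝ, 0 < ε →
    0 < volume {y : ℝ | y ∈ Set.Icc 0 L ∧ |y - x| < ε ∧ n y = nplus} ∧
    0 < volume {y : ℝ | y ∈ Set.Icc 0 L ∧ |y - x| < ε ∧ n y = nminus}

/-- `n` agrees almost everywhere on `[0, L]` with a step function with values `n₊` and `n₋`:
there is a finite partition `0 = x₀ < x₁ < ⋯ < x_N = L` such that on each `(x_j, x_{j+1})` either
`n = n₊` a.e. or `n = n₋` a.e. -/
def IsStepFunction (L nminus nplus : ℝ) (n : ℝ → ℝ) : Prop :=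
  ∃ (N : ℕ) (x : Fin (N + 1) → ℝ), StrictMono x ∧ x 0 = 0 ∧ x (Fin.last N) = L ∧
    ∀ j : Fin N,
      (∀ᵐ y : ℝ, y ∈ Set.Ioo (x j.castSucc) (x j.succ) → n y = nplus) ∨
      (∀ᵐ y : ℝ, y ∈ Set.Ioo (x j.castSucc) (x j.succ) → n y = nminus)

end ScatRes

end

/-!
A nonzero `ω` is a resonance of `n` iff `u'' = -ω² n² u` has a nonzero solution on `[0, L]` with the
outgoing conditions `u' = ∓iωu` at `0` and `L`, that is, iff `ω` is a zero of a characteristic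
function `D_n(ω)`, which is entire in `ω` and continuously differentiable in `n² ∈ L^∞(0, L)`, with
derivative a multiple of `∫ b u²` in the direction `b`. If `ω` is a zero of multiplicity `k`, moving
`n²` by `t b` moves the zeros to `ω + (t c ∫ b u²)^(1/k) (1 + o(1))` for all choices of the root,
with a constant `c ≠ 0`. As `Im ω < 0`, one of these is strictly closer to the real axis whenever
`Im (c ∫ b u²) > 0`, so optimality of `n` makes `∫ (m² - n²) Im (C u²) ≤ 0` for some `C ≠ 0` and all
competitors `m`. Taking `m` extremal according to the sign of `Im (C u²)` shows that `n` itself is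
extremal wherever `Im (C u²) ≠ 0`.

With `C = c²`, the zeros of `Im (C u²)` are those of the real and imaginary parts of `v = c u`. By
symmetry `u` is even or odd about `L / 2`, so the flux `Im (v̄ v')` vanishes at `L / 2`; it is
strictly monotone because `Re ω ≠ 0` and `Im ω < 0`, hence has no other zero. On `(L / 2, L]` the
argument of `v` thus rotates strictly monotonically, and the zeros are finite in number.
-/

noncomputable section

namespace ScatRes

open Set Filter Topology

/-! ### Primitives of integrable functions -/

section Primitive

variable {E F 𝕜 : Type*} [NormedAddCommGroup E] [NormedSpace ℝ E] [NormedAddCommGroup F]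
  [NormedSpace ℝ F] [NormedField 𝕜] [NormedAlgebra ℝ 𝕜] {a b : ℝ}

theorem absolutelyContinuousOnInterval_integral {φ : ℝ → E}
    (h : IntervalIntegrable φ volume a b) :
    AbsolutelyContinuousOnInterval (fun x => ∫ t in a..x, φ t) a b := by
  refine squeeze_zero' (.of_forall fun _ => Finset.sum_nonneg fun _ _ => dist_nonneg) ?_
    (h.norm.absolutelyContinuousOnInterval_intervalIntegral left_mem_uIcc)
  refine eventually_inf_principal.2 (.of_forall fun I hI => Finset.sum_le_sum fun i hi => ?_)
  have hI_mono {x : ℝ} (hx : x ∈ uIcc a b) : uIcc a x ⊆ uIcc a b :=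
    uIcc_subset_uIcc left_mem_uIcc hx
  obtain ⟨hx, hy⟩ := hI.1 i hi
  have hφx := h.mono_set (hI_mono hx)
  have hφy := h.mono_set (hI_mono hy)
  rw [dist_eq_norm, dist_eq_norm, intervalIntegral.integral_interval_sub_left hφx hφy,
    intervalIntegral.integral_interval_sub_left hφx.norm hφy.norm, Real.norm_eq_abs]
  exact intervalIntegral.norm_integral_le_abs_integral_norm

theorem integral_congr_ae_Icc {φ ψ : ℝ → E} (h : φ =ᵐ[volume.restrict (Icc a b)] ψ) {x : ℝ}
    (hx : x ∈ Icc a b) : ∫ t in a..x, φ t = ∫ t in a..x, ψ t := by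
  refine intervalIntegral.integral_congr_ae_restrict (ae_mono (Measure.restrict_mono ?_ le_rfl) h)
  rw [uIoc_of_le hx.1]
  exact Ioc_subset_Icc_self.trans (Icc_subset_Icc_right hx.2)

theorem integral_congr_Icc {φ ψ : ℝ → E} (h : EqOn φ ψ (Icc a b)) {x : ℝ} (hx : x ∈ Icc a b) :
    ∫ t in a..x, φ t = ∫ t in a..x, ψ t :=
  integral_congr_ae_Icc (h.aeEq_restrict measurableSet_Icc) hx

/-- `f` is a primitive on `[a, b]` of the integrable function `φ`, that is, `f` is absolutely
continuous on `[a, b]` with a.e. derivative `φ`. -/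
structure IsPrimitiveOn (f φ : ℝ → E) (a b : ℝ) : Prop where
  integrableOn : IntegrableOn φ (Icc a b)
  eq : ∀ x ∈ Icc a b, f x = f a + ∫ t in a..x, φ t

namespace IsPrimitiveOn

variable {f φ ψ : ℝ → E}

theorem of_integrableOn (hφ : IntegrableOn φ (Icc a b)) :
    IsPrimitiveOn (fun x => ∫ t in a..x, φ t) φ a b where
  integrableOn := hφ
  eq x _ := by rw [intervalIntegral.integral_same, zero_add]

theorem intervalIntegrable (hf : IsPrimitiveOn f φ a b) {x y : ℝ} (hx : x ∈ Icc a b)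
    (hy : y ∈ Icc a b) : IntervalIntegrable φ volume x y :=
  (hf.integrableOn.mono_set (uIcc_subset_Icc hx hy)).intervalIntegrable

theorem sub_eq (hf : IsPrimitiveOn f φ a b) {x y : ℝ} (hx : x ∈ Icc a b) (hy : y ∈ Icc a b) :
    f y - f x = ∫ t in x..y, φ t := by
  have ha : a ∈ Icc a b := left_mem_Icc.2 (hx.1.trans hx.2)
  rw [hf.eq y hy, hf.eq x hx, add_sub_add_left_eq_sub,
    intervalIntegral.integral_interval_sub_left (hf.intervalIntegrable ha hy)
      (hf.intervalIntegrable ha hx)]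

theorem continuousOn (hf : IsPrimitiveOn f φ a b) : ContinuousOn f (Icc a b) :=
  ((continuousOn_const (c := f a)).add
    (intervalIntegral.continuousOn_primitive_Icc hf.integrableOn)).congr fun x hx => by
      simp only [Pi.add_apply, hf.eq x hx, intervalIntegral.integral_of_le hx.1,
        integral_Icc_eq_integral_Ioc]

theorem congr_ae (hf : IsPrimitiveOn f φ a b) (h : φ =ᵐ[volume.restrict (Icc a b)] ψ) :
    IsPrimitiveOn f ψ a b where
  integrableOn := hf.integrableOn.congr h
  eq x hx := by rw [hf.eq x hx, integral_congr_ae_Icc h hx]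

theorem congr (hf : IsPrimitiveOn f φ a b) (h : EqOn φ ψ (Icc a b)) : IsPrimitiveOn f ψ a b :=
  hf.congr_ae (h.aeEq_restrict measurableSet_Icc)

theorem congr_left {g : ℝ → E} (hf : IsPrimitiveOn f φ a b) (h : EqOn f g (Icc a b)) :
    IsPrimitiveOn g φ a b where
  integrableOn := hf.integrableOn
  eq x hx := by rw [← h hx, ← h (left_mem_Icc.2 (hx.1.trans hx.2)), hf.eq x hx]

theorem const_add (c : E) (hf : IsPrimitiveOn f φ a b) :
    IsPrimitiveOn (fun x => c + f x) φ a b where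
  integrableOn := hf.integrableOn
  eq x hx := by rw [hf.eq x hx, add_assoc]

theorem add {g : ℝ → E} (hf : IsPrimitiveOn f φ a b) (hg : IsPrimitiveOn g ψ a b) :
    IsPrimitiveOn (fun x => f x + g x) (fun x => φ x + ψ x) a b where
  integrableOn := hf.integrableOn.add hg.integrableOn
  eq x hx := by
    have ha : a ∈ Icc a b := left_mem_Icc.2 (hx.1.trans hx.2)
    rw [intervalIntegral.integral_add (hf.intervalIntegrable ha hx)
      (hg.intervalIntegrable ha hx), hf.eq x hx, hg.eq x hx, add_add_add_comm]

theorem clm_comp [CompleteSpace E] [CompleteSpace F] (A : E →L[ℝ] F)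
    (hf : IsPrimitiveOn f φ a b) : IsPrimitiveOn (fun x => A (f x)) (fun x => A (φ x)) a b where
  integrableOn := A.integrable_comp hf.integrableOn
  eq x hx := by
    have ha : a ∈ Icc a b := left_mem_Icc.2 (hx.1.trans hx.2)
    rw [hf.eq x hx, map_add, A.intervalIntegral_comp_comm (hf.intervalIntegrable ha hx)]

theorem neg (hf : IsPrimitiveOn f φ a b) :
    IsPrimitiveOn (fun x => -f x) (fun x => -φ x) a b where
  integrableOn := hf.integrableOn.neg
  eq x hx := by rw [hf.eq x hx, neg_add, intervalIntegral.integral_neg]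

theorem of_integrableOn_right (hφ : IntegrableOn φ (Icc a b)) :
    IsPrimitiveOn (fun x => ∫ t in x..b, φ t) (fun x => -φ x) a b := by
  have h := of_integrableOn hφ
  refine (h.neg.const_add (∫ t in a..b, φ t)).congr_left fun x hx => ?_
  have hab := hx.1.trans hx.2
  simp only
  rw [← sub_eq_add_neg, intervalIntegral.integral_interval_sub_left
    (h.intervalIntegrable (left_mem_Icc.2 hab) (right_mem_Icc.2 hab))
    (h.intervalIntegrable (left_mem_Icc.2 hab) hx)]

theorem sub {g : ℝ → E} (hf : IsPrimitiveOn f φ a b) (hg : IsPrimitiveOn g ψ a b) :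
    IsPrimitiveOn (fun x => f x - g x) (fun x => φ x - ψ x) a b := by
  simpa only [sub_eq_add_neg] using hf.add hg.neg

theorem const_mul [CompleteSpace 𝕜] (c : 𝕜) {f φ : ℝ → 𝕜} (hf : IsPrimitiveOn f φ a b) :
    IsPrimitiveOn (fun x => c * f x) (fun x => c * φ x) a b :=
  hf.clm_comp (ContinuousLinearMap.mul ℝ 𝕜 c)

theorem comp_reflect (hf : IsPrimitiveOn f φ a b) :
    IsPrimitiveOn (fun x => f (a + b - x)) (fun x => -φ (a + b - x)) a b where
  integrableOn := by
    have h := ((Measure.measurePreserving_sub_left volume (a + b)).integrableOn_comp_preimage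
      (Homeomorph.subLeft (a + b)).measurableEmbedding).2 hf.integrableOn.neg
    rwa [preimage_const_sub_Icc, add_sub_cancel_right, add_sub_cancel_left] at h
  eq x hx := by
    have hb : b ∈ Icc a b := right_mem_Icc.2 (hx.1.trans hx.2)
    have hx' : a + b - x ∈ Icc a b := ⟨by linarith [hx.2], by linarith [hx.1]⟩
    rw [intervalIntegral.integral_neg, intervalIntegral.integral_comp_sub_left, add_sub_cancel_left,
      ← hf.sub_eq hx' hb, neg_sub, add_sub_cancel]

theorem mul [CompleteSpace 𝕜] {f φ g γ : ℝ → 𝕜} (hf : IsPrimitiveOn f φ a b)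
    (hg : IsPrimitiveOn g γ a b) :
    IsPrimitiveOn (fun x => f x * g x) (fun x => φ x * g x + f x * γ x) a b := by
  have hi : IntegrableOn (fun x => φ x * g x + f x * γ x) (Icc a b) :=
    (hf.integrableOn.mul_continuousOn hg.continuousOn isCompact_Icc).add
      (hg.integrableOn.continuousOn_mul hf.continuousOn isCompact_Icc)
  refine ⟨hi, fun x hx => ?_⟩
  have hab : a ≤ b := hx.1.trans hx.2
  have ha : a ∈ Icc a b := left_mem_Icc.2 hab
  have hb : b ∈ Icc a b := right_mem_Icc.2 hab
  have hi' : IntervalIntegrable (fun x => φ x * g x + f x * γ x) volume a b :=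
    (intervalIntegrable_iff_integrableOn_Icc_of_le hab).2 hi
  have hc (c : 𝕜) : AbsolutelyContinuousOnInterval (fun _ : ℝ => c) a b :=
    (LipschitzWith.const c).lipschitzOnWith.absolutelyContinuousOnInterval (K := 0)
  have hfab := hf.intervalIntegrable ha hb
  have hgab := hg.intervalIntegrable ha hb
  obtain ⟨C, hC⟩ := ((((hc (f a)).fun_add (absolutelyContinuousOnInterval_integral hfab)).fun_smul
    ((hc (g a)).fun_add (absolutelyContinuousOnInterval_integral hgab))).fun_sub
    (absolutelyContinuousOnInterval_integral hi')).const_of_ae_hasDerivAt_zero (by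
      filter_upwards [hfab.ae_hasDerivAt_integral, hgab.ae_hasDerivAt_integral,
        hi'.ae_hasDerivAt_integral] with y h1 h2 h3 hy
      have hd := (((h1 hy a left_mem_uIcc).const_add (f a)).mul
        ((h2 hy a left_mem_uIcc).const_add (g a))).sub (h3 hy a left_mem_uIcc)
      rw [uIcc_of_le hab] at hy
      rwa [← hf.eq y hy, ← hg.eq y hy, sub_self] at hd)
  rw [uIcc_of_le hab] at hC
  have hCx := hC x hx
  have hCa := hC a ha
  simp only [← hf.eq x hx, ← hg.eq x hx, smul_eq_mul] at hCx
  simp only [intervalIntegral.integral_same, add_zero, sub_zero, smul_eq_mul] at hCa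
  rw [hCa, ← hCx, sub_add_cancel]

theorem of_hasDerivAt [CompleteSpace E] (hd : ∀ x, HasDerivAt f (φ x) x) (hφ : Continuous φ) :
    IsPrimitiveOn f φ a b where
  integrableOn := hφ.integrableOn_Icc
  eq x _ := by
    rw [intervalIntegral.integral_eq_sub_of_hasDerivAt (fun y _ => hd y)
      (hφ.intervalIntegrable _ _), add_sub_cancel]

theorem hasDerivWithinAt [CompleteSpace E] (hf : IsPrimitiveOn f φ a b)
    (hφ : ContinuousOn φ (Icc a b)) {x : ℝ} (hx : x ∈ Icc a b) :
    HasDerivWithinAt f (φ x) (Icc a b) x := by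
  have ha : a ∈ Icc a b := left_mem_Icc.2 (hx.1.trans hx.2)
  have := Fact.mk hx
  have hd := intervalIntegral.integral_hasDerivWithinAt_right (s := Icc a b)
    (t := Icc a b) (hf.intervalIntegrable ha hx)
    (hφ.stronglyMeasurableAtFilter_nhdsWithin measurableSet_Icc x) (hφ x hx)
  exact (hd.const_add (f a)).congr_of_mem hf.eq hx

end IsPrimitiveOn

end Primitive

/-! ### Volterra operators on `C([0, L], ℂ)` -/

/-- The space `L^∞([0, L], ℂ)` of coefficients `q` of the equation `u'' = -κ q u`. -/
abbrev Potential (L : ℝ) : Type := Lp ℂ ⊤ (volume.restrict (Icc 0 L))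

section Volterra

variable {L : ℝ}

theorem Potential.integrableOn_mul_iccExtend (hL : 0 ≤ L) (q : Potential L) (u : C(Icc 0 L, ℂ)) :
    IntegrableOn (fun y => q y * IccExtend hL u y) (Icc 0 L) :=
  IntegrableOn.mul_continuousOn ((Lp.memLp q).integrable le_top)
    (u.continuous.Icc_extend' (h := hL)).continuousOn isCompact_Icc

theorem Potential.ae_norm_le (q : Potential L) : ∀ᵐ y, y ∈ Icc 0 L → ‖q y‖ ≤ ‖q‖ :=
  (ae_restrict_iff' measurableSet_Icc).1 (by
    filter_upwards [ae_le_eLpNormEssSup (f := q) (μ := volume.restrict (Icc 0 L))] with y hy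
    rw [← toReal_enorm, Lp.norm_def]
    exact ENNReal.toReal_mono (Lp.eLpNorm_ne_top q) (by rwa [eLpNorm_exponent_top]))

theorem Potential.norm_integral_mul_iccExtend_le (hL : 0 ≤ L) (q : Potential L)
    {u : C(Icc 0 L, ℂ)} {C : ℝ} {k : ℕ}
    (hu : ∀ x : Icc 0 L, ‖u x‖ ≤ C * (x : ℝ) ^ k / k.factorial) (x : Icc 0 L) :
    ‖∫ y in 0..x, q y * IccExtend hL u y‖ ≤
      ‖q‖ * C * (x : ℝ) ^ (k + 1) / (k + 1).factorial := by
  calc ‖∫ y in 0..x, q y * IccExtend hL u y‖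
      ≤ ∫ y in 0..(x : ℝ), ‖q‖ * C / k.factorial * y ^ k := by
        refine intervalIntegral.norm_integral_le_of_norm_le x.2.1 ?_
          (Continuous.intervalIntegrable (by fun_prop) _ _)
        filter_upwards [q.ae_norm_le] with y hy hyx
        have hy' : y ∈ Icc 0 L := ⟨hyx.1.le, hyx.2.trans x.2.2⟩
        calc ‖q y * IccExtend hL u y‖ ≤ ‖q‖ * (C * y ^ k / k.factorial) := by
              rw [norm_mul, IccExtend_of_mem hL u hy']
              gcongr
              exacts [hy hy', hu ⟨y, hy'⟩]
          _ = ‖q‖ * C / k.factorial * y ^ k := by ring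
    _ = ‖q‖ * C * (x : ℝ) ^ (k + 1) / (k + 1).factorial := by
        rw [intervalIntegral.integral_const_mul, integral_pow, Nat.factorial_succ]
        push_cast
        field_simp
        simp

theorem Potential.intervalIntegrable_mul_iccExtend (hL : 0 ≤ L) (q : Potential L)
    (u : C(Icc 0 L, ℂ)) (x : Icc 0 L) :
    IntervalIntegrable (fun y => q y * IccExtend hL u y) volume 0 x :=
  (IsPrimitiveOn.of_integrableOn (q.integrableOn_mul_iccExtend hL u)).intervalIntegrable
    (left_mem_Icc.2 hL) x.2

theorem Potential.continuous_integral_mul_iccExtend (hL : 0 ≤ L) (q : Potential L)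
    (u : C(Icc 0 L, ℂ)) : Continuous fun x : Icc 0 L => ∫ y in 0..x, q y * IccExtend hL u y :=
  (IsPrimitiveOn.of_integrableOn (q.integrableOn_mul_iccExtend hL u)).continuousOn.domRestrict

/-- The bounded bilinear operator `(q, u) ↦ (x ↦ ∫₀ˣ q u)`. -/
def volterra (hL : 0 ≤ L) : Potential L →L[ℂ] C(Icc 0 L, ℂ) →L[ℂ] C(Icc 0 L, ℂ) :=
  LinearMap.mkContinuous₂
    (LinearMap.mk₂ ℂ
      (fun q u => ⟨fun x => ∫ y in 0..x, q y * IccExtend hL u y,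
        q.continuous_integral_mul_iccExtend hL u⟩)
      (fun q q' u => by
        ext x
        simp only [ContinuousMap.coe_mk, ContinuousMap.add_apply]
        rw [← intervalIntegral.integral_add (q.intervalIntegrable_mul_iccExtend hL u x)
          (q'.intervalIntegrable_mul_iccExtend hL u x)]
        refine integral_congr_ae_Icc ?_ x.2
        filter_upwards [Lp.coeFn_add q q'] with y hy
        rw [hy, Pi.add_apply, add_mul])
      (fun c q u => by
        ext x
        simp only [ContinuousMap.coe_mk, ContinuousMap.smul_apply]
        rw [← intervalIntegral.integral_smul]
        refine integral_congr_ae_Icc ?_ x.2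
        filter_upwards [Lp.coeFn_smul c q] with y hy
        rw [hy, Pi.smul_apply, smul_mul_assoc])
      (fun q u v => by
        ext x
        simp only [ContinuousMap.coe_mk, ContinuousMap.add_apply]
        rw [← intervalIntegral.integral_add (q.intervalIntegrable_mul_iccExtend hL u x)
          (q.intervalIntegrable_mul_iccExtend hL v x)]
        simp only [IccExtend, Function.comp_apply, ContinuousMap.add_apply, mul_add])
      (fun c q u => by
        ext x
        simp only [ContinuousMap.coe_mk, ContinuousMap.smul_apply]
        rw [← intervalIntegral.integral_smul]
        simp only [IccExtend, Function.comp_apply, ContinuousMap.smul_apply, mul_smul_comm]))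
    L fun q u => by
      refine (ContinuousMap.norm_le _ (by positivity)).2 fun x => ?_
      calc ‖∫ y in 0..(x : ℝ), q y * IccExtend hL u y‖ ≤ ‖q‖ * ‖u‖ * x := by
            simpa using q.norm_integral_mul_iccExtend_le hL (C := ‖u‖) (k := 0)
              (fun x => by simpa using u.norm_coe_le_norm x) x
        _ ≤ ‖q‖ * ‖u‖ * L := by gcongr; exact x.2.2
        _ = L * ‖q‖ * ‖u‖ := by ring

theorem volterra_apply (hL : 0 ≤ L) (q : Potential L) (u : C(Icc 0 L, ℂ)) (x : Icc 0 L) :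
    volterra hL q u x = ∫ y in 0..x, q y * IccExtend hL u y :=
  rfl

/-- The constant coefficient `1`, for which `volterra` is plain integration. -/
def Potential.unit (L : ℝ) : Potential L :=
  Lp.const ⊤ _ 1

theorem Potential.norm_unit_le : ‖Potential.unit L‖ ≤ 1 := by
  simpa [Potential.unit] using
    Lp.norm_const_le (p := ⊤) (μ := volume.restrict (Icc 0 L)) (c := (1 : ℂ))

theorem volterra_unit_apply (hL : 0 ≤ L) (u : C(Icc 0 L, ℂ)) (x : Icc 0 L) :
    volterra hL (Potential.unit L) u x = ∫ y in 0..x, IccExtend hL u y := by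
  refine integral_congr_ae_Icc ?_ x.2
  filter_upwards [Lp.coeFn_const (p := ⊤) (μ := volume.restrict (Icc 0 L)) (1 : ℂ)] with y hy
  rw [Potential.unit, hy, Function.const_apply, one_mul]

/-- The operator `u ↦ (x ↦ ∫₀ˣ ∫₀ˢ q u)`, a right inverse of `u ↦ u''` composed with
multiplication by `q`. -/
def doubleVolterra (hL : 0 ≤ L) (q : Potential L) : C(Icc 0 L, ℂ) →L[ℂ] C(Icc 0 L, ℂ) :=
  volterra hL (Potential.unit L) * volterra hL q

theorem doubleVolterra_apply (hL : 0 ≤ L) (q : Potential L) (u : C(Icc 0 L, ℂ)) (x : Icc 0 L) :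
    doubleVolterra hL q u x = ∫ s in 0..x, IccExtend hL (volterra hL q u) s :=
  volterra_unit_apply hL _ x

theorem norm_doubleVolterra_pow_apply_le (hL : 0 ≤ L) (q : Potential L) (u : C(Icc 0 L, ℂ))
    (k : ℕ) (x : Icc 0 L) :
    ‖(doubleVolterra hL q ^ k) u x‖ ≤ ‖q‖ ^ k * ‖u‖ * (x : ℝ) ^ (2 * k) / (2 * k).factorial := by
  induction k generalizing x with
  | zero => simpa using u.norm_coe_le_norm x
  | succ k ih =>
    have h := (Potential.unit L).norm_integral_mul_iccExtend_le hL
      (u := volterra hL q ((doubleVolterra hL q ^ k) u)) (q.norm_integral_mul_iccExtend_le hL ih) x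
    rw [pow_succ']
    refine h.trans ?_
    have hx := x.2.1
    calc ‖Potential.unit L‖ * (‖q‖ * (‖q‖ ^ k * ‖u‖)) * (x : ℝ) ^ (2 * k + 1 + 1) /
          (2 * k + 1 + 1).factorial
        ≤ 1 * (‖q‖ * (‖q‖ ^ k * ‖u‖)) * (x : ℝ) ^ (2 * k + 1 + 1) /
          (2 * k + 1 + 1).factorial := by
          gcongr
          exact Potential.norm_unit_le
      _ = ‖q‖ ^ (k + 1) * ‖u‖ * (x : ℝ) ^ (2 * (k + 1)) / (2 * (k + 1)).factorial := by
          rw [one_mul, ← mul_assoc, ← pow_succ']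
          rfl

theorem norm_doubleVolterra_pow_le (hL : 0 ≤ L) (q : Potential L) (k : ℕ) :
    ‖doubleVolterra hL q ^ k‖ ≤ (‖q‖ * L ^ 2) ^ k / k.factorial := by
  refine ContinuousLinearMap.opNorm_le_bound _ (by positivity) fun u =>
    (ContinuousMap.norm_le _ (by positivity)).2 fun x => ?_
  have hx := x.2.1
  calc ‖(doubleVolterra hL q ^ k) u x‖
      ≤ ‖q‖ ^ k * ‖u‖ * (x : ℝ) ^ (2 * k) / (2 * k).factorial :=
        norm_doubleVolterra_pow_apply_le hL q u k x
    _ ≤ ‖q‖ ^ k * ‖u‖ * L ^ (2 * k) / k.factorial := by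
        gcongr
        exacts [x.2.2, by omega]
    _ = (‖q‖ * L ^ 2) ^ k / k.factorial * ‖u‖ := by rw [mul_pow, ← pow_mul]; ring

end Volterra

theorem isUnit_one_sub_of_norm_pow_lt_one {R : Type*} [NormedRing R] [HasSummableGeomSeries R]
    {a : R} {k : ℕ} (h : ‖a ^ k‖ < 1) : IsUnit (1 - a) := by
  have hk : IsUnit ((1 - a) * ∑ i ∈ Finset.range k, a ^ i) := by
    rw [mul_neg_geom_sum]
    exact isUnit_one_sub_of_norm_lt_one h
  refine ((Commute.isUnit_mul_iff ?_).1 hk).1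
  exact Commute.sum_right _ _ _ fun i _ =>
    ((Commute.one_left _).sub_left (Commute.refl a)).pow_right i

theorem isUnit_one_add_smul_of_norm_pow_le {𝕜 R : Type*} [NormedField 𝕜] [NormedRing R]
    [NormedAlgebra 𝕜 R] [HasSummableGeomSeries R] {a : R} {c : ℝ}
    (h : ∀ k : ℕ, ‖a ^ k‖ ≤ c ^ k / k.factorial) (κ : 𝕜) : IsUnit (1 + κ • a) := by
  obtain ⟨k, hk⟩ := ((FloorSemiring.tendsto_pow_div_factorial_atTop (‖κ‖ * c)).eventually
    (gt_mem_nhds zero_lt_one)).exists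
  have hlt : ‖(-κ • a) ^ k‖ < 1 :=
    calc ‖(-κ • a) ^ k‖ = ‖κ‖ ^ k * ‖a ^ k‖ := by
          rw [smul_pow, norm_smul, norm_pow, norm_neg]
      _ ≤ ‖κ‖ ^ k * (c ^ k / k.factorial) := by
          gcongr
          exact h k
      _ < 1 := by rwa [← mul_div_assoc, ← mul_pow]
  simpa using isUnit_one_sub_of_norm_pow_lt_one hlt

theorem isUnit_one_add_smul_doubleVolterra {L : ℝ} (hL : 0 ≤ L) (q : Potential L) (κ : ℂ) :
    IsUnit (1 + κ • doubleVolterra hL q) :=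
  isUnit_one_add_smul_of_norm_pow_le (R := C(Icc 0 L, ℂ) →L[ℂ] C(Icc 0 L, ℂ))
    (norm_doubleVolterra_pow_le hL q) κ

/-! ### The equation `u'' = -κ q u` on `[0, L]` -/

/-- `u` solves `u'' = -κ q u` on `[0, L]` (in the sense of absolutely continuous functions), with
derivative `w`. -/
structure IsSol (L : ℝ) (κ : ℂ) (q u w : ℝ → ℂ) : Prop where
  fst : IsPrimitiveOn u w 0 L
  snd : IsPrimitiveOn w (fun x => -κ * (q x * u x)) 0 L

/-- The path `x ↦ a + c x` on `[0, L]`. -/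
def affinePath (L : ℝ) (a c : ℂ) : C(Icc 0 L, ℂ) :=
  a • 1 + c • ⟨fun x => ((x : ℝ) : ℂ), by fun_prop⟩

theorem affinePath_apply (L : ℝ) (a c : ℂ) (x : Icc 0 L) : affinePath L a c x = a + c * x := by
  simp [affinePath]

/-- The solution of `u'' = -κ q u` on `[0, L]` with `u(0) = a` and `u'(0) = c`, obtained by
inverting the equivalent Volterra integral equation. -/
def solution {L : ℝ} (hL : 0 ≤ L) (q : Potential L) (κ a c : ℂ) : C(Icc 0 L, ℂ) :=
  Ring.inverse (1 + κ • doubleVolterra hL q) (affinePath L a c)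

section Solution

variable {L : ℝ} (hL : 0 ≤ L) (q : Potential L) (κ a c : ℂ)

theorem integral_const_sub_mul_volterra (v : C(Icc 0 L, ℂ)) (x : Icc 0 L) :
    ∫ s in 0..x, (c - κ * IccExtend hL (volterra hL q v) s) =
      c * x - κ * doubleVolterra hL q v x := by
  rw [intervalIntegral.integral_sub intervalIntegrable_const
    (((volterra hL q v).continuous.Icc_extend' (h := hL)).intervalIntegrable _ _ |>.const_mul κ),
    intervalIntegral.integral_const_mul, intervalIntegral.integral_const, doubleVolterra_apply,
    sub_zero, Complex.real_smul, mul_comm]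

theorem solution_add_smul_doubleVolterra :
    solution hL q κ a c + κ • doubleVolterra hL q (solution hL q κ a c) = affinePath L a c :=
  congrArg (fun T : C(Icc 0 L, ℂ) →L[ℂ] C(Icc 0 L, ℂ) => T (affinePath L a c))
    (Ring.mul_inverse_cancel _ (isUnit_one_add_smul_doubleVolterra hL q κ))

variable {κ a c} in
theorem eq_solution {v : C(Icc 0 L, ℂ)} (hv : v + κ • doubleVolterra hL q v = affinePath L a c) :
    v = solution hL q κ a c := by
  rw [solution, ← hv]
  exact (congrArg (fun T : C(Icc 0 L, ℂ) →L[ℂ] C(Icc 0 L, ℂ) => T v)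
    (Ring.inverse_mul_cancel _ (isUnit_one_add_smul_doubleVolterra hL q κ))).symm

theorem solution_apply (x : Icc 0 L) : solution hL q κ a c x =
    a + ∫ s in 0..x, (c - κ * IccExtend hL (volterra hL q (solution hL q κ a c)) s) := by
  have h := congrArg (fun v => v x) (solution_add_smul_doubleVolterra hL q κ a c)
  simp only [ContinuousMap.add_apply, ContinuousMap.smul_apply, affinePath_apply,
    smul_eq_mul] at h
  rw [integral_const_sub_mul_volterra]
  linear_combination h

theorem iccExtend_solution_zero : IccExtend hL (solution hL q κ a c) 0 = a := by
  rw [IccExtend_of_mem hL _ (left_mem_Icc.2 hL), solution_apply, intervalIntegral.integral_same,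
    add_zero]

theorem isSol_solution : IsSol L κ q (IccExtend hL (solution hL q κ a c))
    (fun x => c - κ * ∫ y in 0..x, q y * IccExtend hL (solution hL q κ a c) y) := by
  have hV := (IsPrimitiveOn.of_integrableOn
    (q.integrableOn_mul_iccExtend hL (solution hL q κ a c))).const_mul κ
  refine ⟨⟨(continuousOn_const.sub hV.continuousOn).integrableOn_Icc, fun x hx => ?_⟩, ?_⟩
  · rw [iccExtend_solution_zero, IccExtend_of_mem hL _ hx, solution_apply]
    refine congrArg _ (integral_congr_Icc (fun s hs => ?_) hx)
    rw [IccExtend_of_mem hL _ hs, volterra_apply]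
  · simpa only [neg_mul, ← sub_eq_add_neg] using hV.neg.const_add c

end Solution

namespace IsSol

variable {L : ℝ} {κ : ℂ} {q q₁ q₂ u w u₁ w₁ u₂ w₂ : ℝ → ℂ}

theorem congr_ae (h : IsSol L κ q₁ u w) (hq : q₁ =ᵐ[volume.restrict (Icc 0 L)] q₂) :
    IsSol L κ q₂ u w :=
  ⟨h.fst, h.snd.congr_ae (by filter_upwards [hq] with x hx; rw [hx])⟩

theorem snd_eq (h : IsSol L κ q u w) {x : ℝ} (hx : x ∈ Icc 0 L) :
    w x = w 0 - κ * ∫ y in 0..x, q y * u y := by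
  rw [h.snd.eq x hx, intervalIntegral.integral_const_mul, neg_mul, sub_eq_add_neg]

theorem eqOn_solution (hL : 0 ≤ L) {q : Potential L} (h : IsSol L κ q u w) :
    EqOn u (IccExtend hL (solution hL q κ (u 0) (w 0))) (Icc 0 L) := by
  let v : C(Icc 0 L, ℂ) := ⟨fun x => u x, h.fst.continuousOn.domRestrict⟩
  have hvu : EqOn u (IccExtend hL v) (Icc 0 L) := fun x hx => by
    rw [IccExtend_of_mem hL v hx]
    rfl
  have hv : v + κ • doubleVolterra hL q v = affinePath L (u 0) (w 0) := by
    ext x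
    have hx : v x = u 0 + ∫ s in 0..x, (w 0 - κ * IccExtend hL (volterra hL q v) s) := by
      refine (h.fst.eq x x.2).trans (congrArg _ (integral_congr_Icc (fun s hs => ?_) x.2))
      rw [IccExtend_of_mem hL _ hs, volterra_apply, h.snd_eq hs]
      exact congrArg (w 0 - κ * ·) (integral_congr_Icc (fun y hy => by rw [hvu hy]) hs)
    rw [integral_const_sub_mul_volterra] at hx
    simp only [ContinuousMap.add_apply, ContinuousMap.smul_apply, affinePath_apply, smul_eq_mul]
    linear_combination hx
  rwa [← eq_solution hL q hv]

theorem const_mul (h : IsSol L κ q u w) (c : ℂ) :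
    IsSol L κ q (fun x => c * u x) (fun x => c * w x) :=
  ⟨h.fst.const_mul c, (h.snd.const_mul c).congr fun x _ => by ring⟩

theorem unique (h₁ : IsSol L κ q u₁ w₁) (h₂ : IsSol L κ q u₂ w₂)
    (hq : MemLp q ⊤ (volume.restrict (Icc 0 L))) (hu : u₁ 0 = u₂ 0) (hw : w₁ 0 = w₂ 0) :
    EqOn u₁ u₂ (Icc 0 L) ∧ EqOn w₁ w₂ (Icc 0 L) := by
  have hu' : EqOn u₁ u₂ (Icc 0 L) := fun x hx => by
    have hL := hx.1.trans hx.2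
    rw [(h₁.congr_ae hq.coeFn_toLp.symm).eqOn_solution hL hx,
      (h₂.congr_ae hq.coeFn_toLp.symm).eqOn_solution hL hx, hu, hw]
  refine ⟨hu', fun x hx => ?_⟩
  rw [h₁.snd_eq hx, h₂.snd_eq hx, hw, integral_congr_Icc (fun y hy => by rw [hu' hy]) hx]

theorem wronskian (h₁ : IsSol L κ q₁ u₁ w₁) (h₂ : IsSol L κ q₂ u₂ w₂) :
    IsPrimitiveOn (fun x => w₁ x * u₂ x - u₁ x * w₂ x)
      (fun x => -κ * ((q₁ x - q₂ x) * (u₁ x * u₂ x))) 0 L :=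
  ((h₁.snd.mul h₂.fst).sub (h₁.fst.mul h₂.snd)).congr fun x _ => by ring

theorem initial_eq_zero (h : IsSol L κ q u w) (hq : MemLp q ⊤ (volume.restrict (Icc 0 L)))
    {x : ℝ} (hx : x ∈ Icc 0 L) (hu : u x = 0) (hw : w x = 0) : u 0 = 0 ∧ w 0 = 0 := by
  have hL := hx.1.trans hx.2
  have key (a c : ℂ) : w 0 * a - u 0 * c = 0 := by
    have hW := (h.wronskian
      ((isSol_solution hL (hq.toLp q) κ a c).congr_ae hq.coeFn_toLp)).eq x hx
    simpa only [hu, hw, iccExtend_solution_zero, sub_self, zero_mul, mul_zero, sub_zero,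
      intervalIntegral.integral_same, intervalIntegral.integral_zero, add_zero] using hW.symm
  exact ⟨by simpa using key 0 1, by simpa using key 1 0⟩

theorem reflect (h : IsSol L κ q u w)
    (hq : ∀ᵐ x ∂volume.restrict (Icc 0 L), q (L - x) = q x) :
    IsSol L κ q (fun x => u (L - x)) (fun x => -w (L - x)) := by
  have hu := h.fst.comp_reflect
  have hw := h.snd.comp_reflect.neg
  simp only [zero_add, neg_neg] at hu hw
  exact ⟨hu, hw.congr_ae (by filter_upwards [hq] with x hx; rw [hx])⟩

end IsSol

/-! ### Outgoing modes and the characteristic function -/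

/-- `u` solves `u'' = -ω² q u` on `[0, L]` with `u(0) = 1`, has derivative `w`, and is outgoing at
both ends, so that it extends by multiples of `exp (-iωx)` on the left of `[0, L]` and of
`exp (iωx)` on the right. -/
structure IsMode (L : ℝ) (ω : ℂ) (q u w : ℝ → ℂ) : Prop where
  sol : IsSol L (ω ^ 2) q u w
  one : u 0 = 1
  left : w 0 = -(Complex.I * ω)
  right : w L = Complex.I * ω * u L

theorem IsMode.congr_ae {L : ℝ} {ω : ℂ} {q₁ q₂ u w : ℝ → ℂ} (h : IsMode L ω q₁ u w)
    (hq : q₁ =ᵐ[volume.restrict (Icc 0 L)] q₂) : IsMode L ω q₂ u w :=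
  ⟨h.sol.congr_ae hq, h.one, h.left, h.right⟩

/-- The solution of `u'' = -ω² q u` on `[0, L]` with `u(0) = 1` and `u'(0) = -iω`. -/
def outgoingPath {L : ℝ} (hL : 0 ≤ L) (q : Potential L) (ω : ℂ) : C(Icc 0 L, ℂ) :=
  solution hL q (ω ^ 2) 1 (-(Complex.I * ω))

/-- The characteristic function `ω ↦ u'(L) - iω u(L)`, where `u` is the solution that is outgoing
at `0`; its zeros are the `ω` that admit a mode. -/
def charFun {L : ℝ} (hL : 0 ≤ L) (q : Potential L) (ω : ℂ) : ℂ :=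
  -(Complex.I * ω) - ω ^ 2 * volterra hL q (outgoingPath hL q ω) ⟨L, right_mem_Icc.2 hL⟩ -
    Complex.I * ω * outgoingPath hL q ω ⟨L, right_mem_Icc.2 hL⟩

theorem contDiff_inverse_one_add_smul {𝕜 R P : Type*} [NontriviallyNormedField 𝕜] [NormedRing R]
    [NormedAlgebra 𝕜 R] [HasSummableGeomSeries R] [NormedAddCommGroup P] [NormedSpace 𝕜 P]
    {n : WithTop ℕ∞} (T : P →L[𝕜] R) (hT : ∀ (κ : 𝕜) p, IsUnit (1 + κ • T p)) :
    ContDiff 𝕜 n fun p : 𝕜 × P => Ring.inverse (1 + p.1 • T p.2) :=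
  contDiff_iff_contDiffAt.2 fun p => by
    obtain ⟨x, hx⟩ := hT p.1 p.2
    refine ContDiffAt.comp p (g := Ring.inverse) ?_
      (contDiff_const.add (contDiff_fst.smul (T.contDiff.comp contDiff_snd))).contDiffAt
    rw [← hx]
    exact contDiffAt_ringInverse 𝕜 x

section CharFun

variable {L : ℝ} (hL : 0 ≤ L) (q : Potential L) {ω : ℂ} {u w : ℝ → ℂ}

theorem exists_isSol_outgoingPath (ω : ℂ) : ∃ w, IsSol L (ω ^ 2) q
    (IccExtend hL (outgoingPath hL q ω)) w ∧ w 0 = -(Complex.I * ω) :=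
  ⟨_, isSol_solution hL q _ _ _, by simp⟩

theorem iccExtend_outgoingPath_zero (ω : ℂ) : IccExtend hL (outgoingPath hL q ω) 0 = 1 :=
  iccExtend_solution_zero hL q _ _ _

variable {q} in
theorem IsSol.eqOn_outgoingPath (h : IsSol L (ω ^ 2) q u w) (h0 : u 0 = 1)
    (h1 : w 0 = -(Complex.I * ω)) : EqOn u (IccExtend hL (outgoingPath hL q ω)) (Icc 0 L) := by
  rw [outgoingPath, ← h0, ← h1]
  exact h.eqOn_solution hL

variable {q} in
theorem charFun_eq (h : IsSol L (ω ^ 2) q u w) (h0 : u 0 = 1) (h1 : w 0 = -(Complex.I * ω)) :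
    charFun hL q ω = w L - Complex.I * ω * u L := by
  have hLL := right_mem_Icc.2 hL
  have hu := h.eqOn_outgoingPath hL h0 h1
  have hqu : EqOn (fun y => q y * u y) (fun y => q y * IccExtend hL (outgoingPath hL q ω) y)
      (Icc 0 L) := fun y hy => congrArg (q y * ·) (hu hy)
  rw [h.snd_eq hLL, h1, hu hLL, IccExtend_of_mem hL _ hLL, charFun, volterra_apply,
    integral_congr_Icc hqu hLL]

theorem charFun_eq_zero_iff : charFun hL q ω = 0 ↔ ∃ u w, IsMode L ω q u w := by
  refine ⟨fun h => ?_, fun ⟨u, w, h⟩ => ?_⟩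
  · obtain ⟨w, hsol, h1⟩ := exists_isSol_outgoingPath hL q ω
    have h0 := iccExtend_outgoingPath_zero hL q ω
    rw [charFun_eq hL hsol h0 h1] at h
    exact ⟨_, w, hsol, h0, h1, sub_eq_zero.1 h⟩
  · rw [charFun_eq hL h.sol h.one h.left, h.right, sub_self]

theorem contDiff_outgoingPath :
    ContDiff ℂ 1 fun p : ℂ × Potential L => outgoingPath hL p.2 p.1 := by
  have hop := contDiff_inverse_one_add_smul (R := C(Icc 0 L, ℂ) →L[ℂ] C(Icc 0 L, ℂ)) (n := 1)
    ((ContinuousLinearMap.compL ℂ C(Icc 0 L, ℂ) C(Icc 0 L, ℂ) C(Icc 0 L, ℂ)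
      (volterra hL (Potential.unit L))).comp (volterra hL))
    fun κ q => isUnit_one_add_smul_doubleVolterra hL q κ
  have hinv : ContDiff ℂ 1 fun p : ℂ × Potential L => Ring.inverse
      (1 + p.1 ^ 2 • doubleVolterra hL p.2 : C(Icc 0 L, ℂ) →L[ℂ] C(Icc 0 L, ℂ)) :=
    hop.comp (f := fun p : ℂ × Potential L => (p.1 ^ 2, p.2)) (by fun_prop)
  refine hinv.clm_apply ?_
  simp only [affinePath]
  fun_prop

theorem contDiff_charFun : ContDiff ℂ 1 fun p : ℂ × Potential L => charFun hL p.2 p.1 := by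
  have ho := contDiff_outgoingPath hL
  have hL' : ContDiff ℂ 1 fun v : C(Icc 0 L, ℂ) => v ⟨L, right_mem_Icc.2 hL⟩ :=
    ContinuousLinearMap.contDiff (E := C(Icc 0 L, ℂ)) (F := ℂ) (ContinuousMap.evalCLM ℂ _)
  have hv := hL'.comp ((((volterra hL).contDiff.comp contDiff_snd)).clm_apply ho)
  exact (ContDiff.sub (by fun_prop) (ContDiff.mul (by fun_prop) hv)).sub
    (ContDiff.mul (by fun_prop) (hL'.comp ho))

theorem differentiable_charFun : Differentiable ℂ (charFun hL q) :=
  ((contDiff_charFun hL).differentiable one_ne_zero).comp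
    (differentiable_id.prodMk (differentiable_const q))

variable {q} in
theorem IsMode.mul_charFun (hm : IsMode L ω q u w) (r : Potential L) :
    u L * charFun hL r ω = -ω ^ 2 * ∫ y in 0..L,
      (r y - q y) * (IccExtend hL (outgoingPath hL r ω) y * u y) := by
  obtain ⟨w', hsol, h1⟩ := exists_isSol_outgoingPath hL r ω
  have h0 := iccExtend_outgoingPath_zero hL r ω
  have hW := (hsol.wronskian hm.sol).eq L (right_mem_Icc.2 hL)
  rw [charFun_eq hL hsol h0 h1]
  simp only [h0, h1, hm.one, hm.left, hm.right, intervalIntegral.integral_const_mul] at hW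
  linear_combination hW

variable {q} in
theorem IsMode.hasDerivAt_charFun (hm : IsMode L ω q u w) (huL : u L ≠ 0) (b : Potential L) :
    HasDerivAt (fun t : ℂ => charFun hL (q + t • b) ω)
      (-ω ^ 2 / u L * ∫ y in 0..L, b y * u y ^ 2) 0 := by
  have hLL := right_mem_Icc.2 hL
  have hu := hm.sol.eqOn_outgoingPath hL hm.one hm.left
  let o (t : ℂ) : C(Icc 0 L, ℂ) := outgoingPath hL (q + t • b) ω
  have ho : Continuous o :=
    (contDiff_outgoingPath hL).continuous.comp (f := fun t => (ω, q + t • b)) (by fun_prop)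
  let H (t : ℂ) : ℂ := -ω ^ 2 / u L * volterra hL b (o t * outgoingPath hL q ω) ⟨L, hLL⟩
  have hH : Continuous H := continuous_const.mul ((continuous_eval_const _).comp
    ((volterra hL b).continuous.comp (ho.mul continuous_const)))
  have hFH (t : ℂ) : charFun hL (q + t • b) ω = t * H t := by
    have hint : ∫ y in 0..L, ((q + t • b : Potential L) y - q y) * (IccExtend hL (o t) y * u y) =
        t * volterra hL b (o t * outgoingPath hL q ω) ⟨L, hLL⟩ := by
      rw [volterra_apply, ← intervalIntegral.integral_const_mul]
      refine integral_congr_ae_Icc ?_ hLL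
      filter_upwards [Lp.coeFn_add q (t • b), Lp.coeFn_smul t b,
        ae_restrict_mem measurableSet_Icc] with y hadd hsmul hy
      rw [hadd, Pi.add_apply, hsmul, Pi.smul_apply, add_sub_cancel_left, smul_eq_mul, mul_assoc,
        hu hy]
      rfl
    have hchar := hm.mul_charFun hL (q + t • b)
    rw [hint] at hchar
    refine mul_left_cancel₀ huL (hchar.trans ?_)
    simp only [H]
    field_simp
  have hH0 : H 0 = -ω ^ 2 / u L * ∫ y in 0..L, b y * u y ^ 2 := by
    simp only [H, o, zero_smul, add_zero, volterra_apply]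
    refine congrArg _ (integral_congr_Icc (fun y hy => ?_) hLL)
    simp only [sq, hu hy]
    rfl
  rw [← hH0, hasDerivAt_iff_tendsto_slope]
  refine ((hH.tendsto 0).mono_left nhdsWithin_le_nhds).congr' ?_
  filter_upwards [self_mem_nhdsWithin] with t ht
  rw [slope_def_field, hFH, hFH, zero_mul, sub_zero, sub_zero, mul_div_cancel_left₀ _ ht]

end CharFun

/-! ### Resonances as zeros of the characteristic function -/

/-- The potential `x ↦ ω² ∫₀ᴸ G(|x - y|, ω) h(y) dy` of the density `h` on `[0, L]`. -/
def greenPotential (L : ℝ) (ω : ℂ) (h : ℝ → ℂ) (x : ℝ) : ℂ :=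
  ω ^ 2 * ∫ y in Icc 0 L, green |x - y| ω * h y

section GreenPotential

variable {L : ℝ} {ω : ℂ} {h : ℝ → ℂ}

theorem I_mul_mul_I_mul_self (ω : ℂ) : Complex.I * ω * (Complex.I * ω) = -ω ^ 2 := by
  rw [mul_mul_mul_comm, Complex.I_mul_I]
  ring

theorem exp_mul_exp_neg (α : ℂ) (x : ℝ) : Complex.exp (α * x) * Complex.exp (-α * x) = 1 := by
  rw [← Complex.exp_add, neg_mul, add_neg_cancel, Complex.exp_zero]

theorem sq_mul_green_sub_of_le (hω : ω ≠ 0) {x y : ℝ} (hyx : y ≤ x) :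
    ω ^ 2 * green |x - y| ω = Complex.I * ω / 2 *
      (Complex.exp (Complex.I * ω * x) * Complex.exp (-(Complex.I * ω) * y)) := by
  rw [green, abs_of_nonneg (sub_nonneg.2 hyx), ← Complex.exp_add, Complex.ofReal_sub, mul_sub,
    neg_mul (Complex.I * ω), ← sub_eq_add_neg, mul_inv, mul_inv, Complex.inv_I]
  field_simp

theorem continuous_greenPotential (hh : IntegrableOn h (Icc 0 L)) :
    Continuous (greenPotential L ω h) := by
  refine continuous_const.mul (continuous_iff_continuousAt.2 fun x₀ => ?_)
  have hg : Continuous fun p : ℝ × ℝ => green |p.1 - p.2| ω := by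
    unfold green
    fun_prop
  obtain ⟨C, hC⟩ := ((isCompact_closedBall x₀ 1).prod
    (isCompact_Icc (a := 0) (b := L))).exists_bound_of_continuousOn hg.continuousOn
  refine continuousAt_of_dominated (bound := fun y => C * ‖h y‖) ?_ ?_ (hh.norm.const_mul C) ?_
  · exact .of_forall fun x => (Continuous.aestronglyMeasurable
      (hg.comp (Continuous.prodMk_right x))).mul hh.aestronglyMeasurable
  · filter_upwards [Metric.closedBall_mem_nhds x₀ one_pos] with x hx
    filter_upwards [ae_restrict_mem measurableSet_Icc] with y hy
    rw [norm_mul]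
    gcongr
    exact hC (x, y) ⟨hx, hy⟩
  · exact .of_forall fun y =>
      ((hg.comp (Continuous.prodMk_left y)).mul continuous_const).continuousAt

theorem greenPotential_eq (hω : ω ≠ 0) (hh : IntegrableOn h (Icc 0 L)) {x : ℝ}
    (hx : x ∈ Icc 0 L) : greenPotential L ω h x = Complex.I * ω / 2 *
      (Complex.exp (Complex.I * ω * x) * (∫ y in 0..x, Complex.exp (-(Complex.I * ω) * y) * h y) +
        Complex.exp (-(Complex.I * ω) * x) *
          ∫ y in x..L, Complex.exp (Complex.I * ω * y) * h y) := by
  have hL : (0 : ℝ) ≤ L := hx.1.trans hx.2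
  have hG := IsPrimitiveOn.of_integrableOn (hh.continuousOn_mul
    (g := fun y : ℝ => green |x - y| ω) (by unfold green; fun_prop) isCompact_Icc)
  have hleft : ω ^ 2 * ∫ y in 0..x, green |x - y| ω * h y = Complex.I * ω / 2 *
      Complex.exp (Complex.I * ω * x) *
        ∫ y in 0..x, Complex.exp (-(Complex.I * ω) * y) * h y := by
    simp only [← intervalIntegral.integral_const_mul]
    refine integral_congr_Icc (fun y hy => ?_) (right_mem_Icc.2 hx.1)
    simp only [← mul_assoc, sq_mul_green_sub_of_le hω hy.2]
  have hright : ω ^ 2 * ∫ y in x..L, green |x - y| ω * h y = Complex.I * ω / 2 *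
      Complex.exp (-(Complex.I * ω) * x) *
        ∫ y in x..L, Complex.exp (Complex.I * ω * y) * h y := by
    simp only [← intervalIntegral.integral_const_mul]
    refine integral_congr_Icc (fun y hy => ?_) (right_mem_Icc.2 hx.2)
    rw [← mul_assoc, abs_sub_comm, sq_mul_green_sub_of_le hω hy.1]
    ring
  rw [greenPotential, integral_Icc_eq_integral_Ioc, ← intervalIntegral.integral_of_le hL,
    ← intervalIntegral.integral_add_adjacent_intervals
      (hG.intervalIntegrable (left_mem_Icc.2 hL) hx)
      (hG.intervalIntegrable hx (right_mem_Icc.2 hL)), mul_add, hleft, hright]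
  ring

theorem isPrimitiveOn_exp (α : ℂ) (a b : ℝ) :
    IsPrimitiveOn (fun x => Complex.exp (α * x)) (fun x => α * Complex.exp (α * x)) a b := by
  refine .of_hasDerivAt (fun x => ?_) (by fun_prop)
  simpa [mul_comm] using ((Complex.ofRealCLM.hasDerivAt (x := x)).const_mul α).cexp

theorem exists_isPrimitiveOn_greenPotential (hL : 0 ≤ L) (hω : ω ≠ 0)
    (hh : IntegrableOn h (Icc 0 L)) : ∃ W : ℝ → ℂ,
      IsPrimitiveOn (greenPotential L ω h) W 0 L ∧
      IsPrimitiveOn W (fun x => -ω ^ 2 * (greenPotential L ω h x + h x)) 0 L ∧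
      W 0 = -(Complex.I * ω) * greenPotential L ω h 0 ∧
      W L = Complex.I * ω * greenPotential L ω h L := by
  let α : ℂ := Complex.I * ω
  have hα2 : α * α = -ω ^ 2 := I_mul_mul_I_mul_self ω
  let E (x : ℝ) : ℂ := Complex.exp (α * x)
  let E' (x : ℝ) : ℂ := Complex.exp (-α * x)
  let A (x : ℝ) : ℂ := ∫ y in 0..x, E' y * h y
  let B (x : ℝ) : ℂ := ∫ y in x..L, E y * h y
  have hEE' (x : ℝ) : E x * E' x = 1 := exp_mul_exp_neg α x
  have hint (β : ℂ) : IntegrableOn (fun y : ℝ => Complex.exp (β * y) * h y) (Icc 0 L) :=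
    hh.continuousOn_mul (by fun_prop) isCompact_Icc
  have hE : IsPrimitiveOn E (fun x => α * E x) 0 L := isPrimitiveOn_exp α 0 L
  have hE' : IsPrimitiveOn E' (fun x => -α * E' x) 0 L := isPrimitiveOn_exp (-α) 0 L
  have hA : IsPrimitiveOn A (fun x => E' x * h x) 0 L := .of_integrableOn (hint (-α))
  have hB : IsPrimitiveOn B (fun x => -(E x * h x)) 0 L := .of_integrableOn_right (hint α)
  have hU (x : ℝ) (hx : x ∈ Icc 0 L) :
      greenPotential L ω h x = α / 2 * (E x * A x + E' x * B x) := greenPotential_eq hω hh hx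
  refine ⟨fun x => α * α / 2 * (E x * A x - E' x * B x), ?_, ?_, ?_, ?_⟩
  · refine ((((hE.mul hA).add (hE'.mul hB)).const_mul (α / 2)).congr fun x _ => ?_).congr_left
      fun x hx => (hU x hx).symm
    ring
  · refine (((hE.mul hA).sub (hE'.mul hB)).const_mul (α * α / 2)).congr fun x hx => ?_
    simp only
    rw [hU x hx]
    linear_combination α * α * h x * hEE' x +
      (h x + α / 2 * (E x * A x + E' x * B x)) * hα2
  · simp only [hU 0 (left_mem_Icc.2 hL), A, intervalIntegral.integral_same]
    ring
  · simp only [hU L (right_mem_Icc.2 hL), B, intervalIntegral.integral_same]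
    ring

theorem eqOn_zero_of_outgoing {d d' : ℝ → ℂ} (hω : ω ≠ 0) (h : IsSol L (ω ^ 2) (fun _ => 1) d d')
    (hleft : d' 0 = -(Complex.I * ω) * d 0) (hright : d' L = Complex.I * ω * d L) :
    EqOn d 0 (Icc 0 L) := by
  intro x hx
  set α : ℂ := Complex.I * ω
  have hα2 : α * α = -ω ^ 2 := I_mul_mul_I_mul_self ω
  have hα0 : α ≠ 0 := mul_ne_zero Complex.I_ne_zero hω
  have hconst (β : ℂ) (hβ : β * β = -ω ^ 2) {y : ℝ} (hy : y ∈ Icc 0 L) (h0 : d' y = β * d y) :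
      d' x = β * d x := by
    have hprim : IsPrimitiveOn (fun x : ℝ => Complex.exp (β * x) * (d' x - β * d x))
        (fun _ => 0) 0 L :=
      ((isPrimitiveOn_exp β 0 L).mul (h.snd.sub (h.fst.const_mul β))).congr fun x _ => by
        linear_combination -Complex.exp (β * x) * d x * hβ
    have hsub := hprim.sub_eq hy hx
    rw [h0, sub_self, mul_zero, sub_zero, intervalIntegral.integral_zero] at hsub
    exact sub_eq_zero.1 ((mul_eq_zero.1 hsub).resolve_left (Complex.exp_ne_zero _))
  have hL := hx.1.trans hx.2
  have h1 := hconst α hα2 (right_mem_Icc.2 hL) hright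
  have h2 := hconst (-α) (by rw [neg_mul_neg, hα2]) (left_mem_Icc.2 hL) hleft
  refine (mul_eq_zero.1 (?_ : 2 * α * d x = 0)).resolve_left (mul_ne_zero two_ne_zero hα0)
  linear_combination h2 - h1

end GreenPotential

/-- The square `n²` of an index, as a complex-valued coefficient. -/
def sqIndex (n : ℝ → ℝ) (x : ℝ) : ℂ := ((n x ^ 2 : ℝ) : ℂ)

theorem memLp_sqIndex {L a b : ℝ} {n : ℝ → ℝ} (hn : n ∈ Admissible L a b) :
    MemLp (sqIndex n) ⊤ (volume.restrict (Icc 0 L)) := by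
  refine memLp_top_of_bound (Complex.measurable_ofReal.comp_aemeasurable
    (hn.1.restrict.pow_const 2)).aestronglyMeasurable (max |a| |b| ^ 2) ?_
  filter_upwards [ae_restrict_of_ae hn.2.2, ae_restrict_mem measurableSet_Icc] with x hx hxL
  rw [sqIndex, Complex.norm_real, norm_pow, Real.norm_eq_abs]
  gcongr
  exact abs_le_max_abs_abs (hx hxL).1 (hx hxL).2

section Resonance

variable {L : ℝ} {n : ℝ → ℝ} {ω : ℂ}

theorem IsResonancePair.ae_eq_greenPotential {u : ℝ → ℂ} (hu : IsResonancePair L n ω u) :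
    u =ᵐ[volume] greenPotential L ω fun y => (sqIndex n y - 1) * u y := by
  filter_upwards [hu.equation] with x hx
  simp only [hx, greenPotential, sqIndex, Complex.ofReal_pow, mul_assoc]

theorem ne_zero_of_mem_res (hω : ω ∈ Res L n) : ω ≠ 0 := by
  rintro rfl
  obtain ⟨u, hu⟩ := hω
  refine hu.nontrivial (hu.equation.mono fun x hx => ?_)
  rw [hx, zero_pow two_ne_zero, zero_mul, Pi.zero_apply]

theorem IsSol.eqOn_zero {κ : ℂ} {q u w : ℝ → ℂ} (h : IsSol L κ q u w)
    (hq : MemLp q ⊤ (volume.restrict (Icc 0 L))) (hu : u 0 = 0) (hw : w 0 = 0) :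
    EqOn u 0 (Icc 0 L) := by
  have h0 := h.const_mul 0
  intro x hx
  simpa using (h.unique h0 hq (by simp [hu]) (by simp [hw])).1 hx

theorem exists_isMode_of_mem_res (hL : 0 ≤ L)
    (hq : MemLp (sqIndex n) ⊤ (volume.restrict (Icc 0 L))) (hres : ω ∈ Res L n) :
    ∃ u w, IsMode L ω (sqIndex n) u w := by
  have hω := ne_zero_of_mem_res hres
  obtain ⟨u, hu⟩ := hres
  have hint : IntegrableOn (fun y => (sqIndex n y - 1) * u y) (Icc 0 L) :=
    (hu.locallyIntegrable.integrableOn_isCompact isCompact_Icc).mul_of_top_right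
      (hq.sub (memLp_top_const 1))
  have huU := hu.ae_eq_greenPotential
  obtain ⟨W, hfst, hsnd, hleft, hright⟩ := exists_isPrimitiveOn_greenPotential hL hω hint
  set U := greenPotential L ω fun y => (sqIndex n y - 1) * u y with hU
  have hsol : IsSol L (ω ^ 2) (sqIndex n) U W := by
    refine ⟨hfst, hsnd.congr_ae ?_⟩
    filter_upwards [ae_restrict_of_ae huU] with x hx
    rw [hx]
    ring
  have hU0 : U 0 ≠ 0 := fun h0 => by
    have hUz := hsol.eqOn_zero hq h0 (by rw [hleft, h0, mul_zero])
    have hU_zero (x : ℝ) : U x = 0 := by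
      rw [hU, greenPotential, integral_eq_zero_of_ae, mul_zero]
      filter_upwards [ae_restrict_of_ae huU, ae_restrict_mem measurableSet_Icc] with y hy hyL
      rw [hy, hUz hyL, Pi.zero_apply, mul_zero, mul_zero]
    exact hu.nontrivial (huU.trans (.of_forall hU_zero))
  refine ⟨_, _, hsol.const_mul (U 0)⁻¹, inv_mul_cancel₀ hU0, ?_, ?_⟩
  · rw [hleft, mul_left_comm, inv_mul_cancel₀ hU0, mul_one]
  · rw [hright, mul_left_comm]

theorem IsMode.mem_res {u w : ℝ → ℂ} (hm : IsMode L ω (sqIndex n) u w) (hL : 0 ≤ L) (hω : ω ≠ 0)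
    (hq : MemLp (sqIndex n) ⊤ (volume.restrict (Icc 0 L))) : ω ∈ Res L n := by
  have hint : IntegrableOn (fun y => (sqIndex n y - 1) * u y) (Icc 0 L) :=
    IntegrableOn.mul_continuousOn ((hq.sub (memLp_top_const 1)).integrable le_top)
      hm.sol.fst.continuousOn isCompact_Icc
  obtain ⟨W, hfst, hsnd, hleft, hright⟩ := exists_isPrimitiveOn_greenPotential hL hω hint
  set U := greenPotential L ω fun y => (sqIndex n y - 1) * u y
  have huU : EqOn u U (Icc 0 L) := fun x hx => sub_eq_zero.1 <| by
    refine eqOn_zero_of_outgoing (d := fun x => u x - U x) (d' := fun x => w x - W x) hω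
      ⟨hm.sol.fst.sub hfst, (hm.sol.snd.sub hsnd).congr fun x _ => ?_⟩ ?_ ?_ hx
    · simp only
      ring
    · rw [hm.left, hleft, hm.one]
      ring
    · rw [hm.right, hright]
      ring
  have hcont : Continuous U := continuous_greenPotential hint
  refine ⟨U, hcont.locallyIntegrable, fun h0 => ?_, .of_forall fun x => ?_⟩
  · have hU0 := congrFun ((hcont.ae_eq_iff_eq volume continuous_zero).1 h0) 0
    rw [← huU (left_mem_Icc.2 hL), hm.one] at hU0
    exact one_ne_zero hU0
  · change greenPotential L ω (fun y => (sqIndex n y - 1) * u y) x = _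
    refine congrArg _ (setIntegral_congr_fun measurableSet_Icc fun y hy => ?_)
    change _ * ((((n y ^ 2 : ℝ) : ℂ) - 1) * u y) = _ * ((n y : ℂ) ^ 2 - 1) * U y
    rw [← huU hy, Complex.ofReal_pow, mul_assoc]

theorem mem_res_iff_charFun_eq_zero (hL : 0 ≤ L) (hω : ω ≠ 0)
    (hq : MemLp (sqIndex n) ⊤ (volume.restrict (Icc 0 L))) :
    ω ∈ Res L n ↔ charFun hL (hq.toLp _) ω = 0 := by
  rw [charFun_eq_zero_iff]
  refine ⟨fun h => ?_, fun ⟨u, w, hm⟩ => (hm.congr_ae hq.coeFn_toLp).mem_res hL hω hq⟩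
  obtain ⟨u, w, hm⟩ := exists_isMode_of_mem_res hL hq h
  exact ⟨u, w, hm.congr_ae hq.coeFn_toLp.symm⟩

end Resonance

/-! ### Zeros of plane curves with nonvanishing flux -/

section Curve

variable {v v' : ℝ → ℂ} {a b : ℝ}

theorem im_conj_mul (z z' : ℂ) : ((starRingEnd ℂ) z * z').im = z.re * z'.im - z.im * z'.re := by
  rw [Complex.mul_im, Complex.conj_re, Complex.conj_im]
  ring

theorem eq_zero_of_frequently_eq_zero {f : ℝ → ℝ} {f' x : ℝ} {s : Set ℝ}
    (hd : HasDerivWithinAt f f' s x) (hf : ∃ᶠ y in 𝓝[s \ {x}] x, f y = 0) :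
    f x = 0 ∧ f' = 0 := by
  have h0 : f x = 0 := by
    by_contra hne
    exact hf ((hd.continuousWithinAt.mono_left (nhdsWithin_mono _ sdiff_subset)).eventually_ne hne)
  refine ⟨h0, ?_⟩
  by_contra hne
  refine hf (((hasDerivWithinAt_iff_tendsto_slope.1 hd).eventually_ne hne).mono fun y hy hy0 =>
    hy ?_)
  rw [slope_def_field, hy0, h0, sub_self, zero_div]

-- The flux `Im (v̄ v')` is the Wronskian of `re v` and `im v`, so Rolle's theorem applied to
-- `re v / im v` makes their zeros interlace.
theorem exists_im_eq_zero_of_re_eq_zero (hab : a < b)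
    (hd : ∀ x ∈ Icc a b, HasDerivWithinAt v (v' x) (Icc a b) x)
    (hJ : ∀ x ∈ Icc a b, ((starRingEnd ℂ) (v x) * v' x).im ≠ 0)
    (ha : (v a).re = 0) (hb : (v b).re = 0) : ∃ x ∈ Icc a b, (v x).im = 0 := by
  by_contra! hne
  have hc : ContinuousOn v (Icc a b) := fun x hx => (hd x hx).continuousWithinAt
  obtain ⟨x, hx, hx0⟩ := exists_hasDerivAt_eq_zero (f := fun x => (v x).re / (v x).im)
    (f' := fun x => ((v' x).re * (v x).im - (v x).re * (v' x).im) / (v x).im ^ 2) hab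
    ((Complex.continuous_re.comp_continuousOn hc).div
      (Complex.continuous_im.comp_continuousOn hc) hne)
    (by rw [ha, hb, zero_div, zero_div]) fun x hx => by
      have hx' := Ioo_subset_Icc_self hx
      have h : HasDerivAt v (v' x) x := (hd x hx').hasDerivAt (Icc_mem_nhds hx.1 hx.2)
      exact (Complex.reCLM.hasFDerivAt.comp_hasDerivAt x h).div
        (Complex.imCLM.hasFDerivAt.comp_hasDerivAt x h) (hne x hx')
  have hx' := Ioo_subset_Icc_self hx
  refine hJ x hx' ?_
  have h := (div_eq_zero_iff.1 hx0).resolve_right (pow_ne_zero 2 (hne x hx'))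
  rw [im_conj_mul]
  linarith

theorem frequently_im_eq_zero (hab : a < b)
    (hd : ∀ x ∈ Icc a b, HasDerivWithinAt v (v' x) (Icc a b) x)
    (hJ : ∀ x ∈ Ioc a b, ((starRingEnd ℂ) (v x) * v' x).im ≠ 0)
    (hre : ∃ᶠ x in 𝓝[>] a, (v x).re = 0) : ∃ᶠ x in 𝓝[>] a, (v x).im = 0 := by
  have hex := (nhdsGT_basis a).frequently_iff.1 hre
  refine (nhdsGT_basis a).frequently_iff.2 fun ε hε => ?_
  obtain ⟨y, hy, hy0⟩ := hex (min ε b) (lt_min hε hab)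
  obtain ⟨x, hx, hx0⟩ := hex y hy.1
  have hyb : y ≤ b := (hy.2.trans_le (min_le_right _ _)).le
  have hsub : Icc x y ⊆ Icc a b := Icc_subset_Icc hx.1.le hyb
  obtain ⟨z, hz, hz0⟩ := exists_im_eq_zero_of_re_eq_zero hx.2
    (fun z hz => (hd z (hsub hz)).mono hsub)
    (fun z hz => hJ z ⟨hx.1.trans_le hz.1, hz.2.trans hyb⟩) hx0 hy0
  exact ⟨z, ⟨hx.1.trans_le hz.1, hz.2.trans_lt (hy.2.trans_le (min_le_left _ _))⟩, hz0⟩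

theorem finite_re_eq_zero (hd : ∀ x ∈ Icc a b, HasDerivWithinAt v (v' x) (Icc a b) x)
    (hJ : ∀ x ∈ Ioc a b, ((starRingEnd ℂ) (v x) * v' x).im ≠ 0)
    (ha : ¬(v a = 0 ∧ v' a = 0)) : {x ∈ Icc a b | (v x).re = 0}.Finite := by
  by_contra hinf
  obtain ⟨x, hx, hacc⟩ :=
    Set.Infinite.exists_accPt_of_subset_isCompact hinf isCompact_Icc fun y hy => hy.1
  have hfr : ∃ᶠ y in 𝓝[Icc a b \ {x}] x, (v y).re = 0 := by
    rw [frequently_nhdsWithin_iff]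
    exact (accPt_iff_frequently.1 hacc).mono fun y hy => ⟨hy.2.2, hy.2.1, hy.1⟩
  obtain ⟨hre, hre'⟩ := eq_zero_of_frequently_eq_zero
    (Complex.reCLM.hasFDerivAt.comp_hasDerivWithinAt x (hd x hx)) hfr
  rw [Complex.reCLM_apply] at hre'
  rcases hx.1.eq_or_lt with rfl | hax
  · have hab : a < b := by
      refine hx.2.lt_of_ne fun hab => ?_
      simp [hab] at hfr
    have hnhds : 𝓝[Icc a b \ {a}] a = 𝓝[>] a := by
      rw [Icc_sdiff_left, nhdsWithin_Ioc_eq_nhdsGT hab]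
    obtain ⟨him, him'⟩ := eq_zero_of_frequently_eq_zero
      (Complex.imCLM.hasFDerivAt.comp_hasDerivWithinAt a (hd a hx))
      (hnhds ▸ frequently_im_eq_zero hab hd hJ (hnhds ▸ hfr))
    exact ha ⟨Complex.ext hre him, Complex.ext hre' him'⟩
  · refine hJ x ⟨hax, hx.2⟩ ?_
    rw [im_conj_mul, show (v x).re = 0 from hre, hre', zero_mul, mul_zero, sub_zero]

end Curve

/-! ### Modes of real densities -/

section RealDensity

variable {L : ℝ} {ω : ℂ} {p : ℝ → ℝ} {u w : ℝ → ℂ}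

theorem IsSol.flux_sub {κ : ℂ} (h : IsSol L κ (fun x => (p x : ℂ)) u w) {a b : ℝ}
    (ha : a ∈ Icc 0 L) (hb : b ∈ Icc 0 L) :
    ((starRingEnd ℂ) (u b) * w b).im - ((starRingEnd ℂ) (u a) * w a).im =
      -κ.im * ∫ y in a..b, p y * ‖u y‖ ^ 2 := by
  have hJ := ((h.fst.clm_comp Complex.conjCLE.toContinuousLinearMap).mul h.snd).clm_comp
    Complex.imCLM
  refine (hJ.sub_eq ha hb).trans ?_
  rw [← intervalIntegral.integral_const_mul]
  refine intervalIntegral.integral_congr fun y _ => ?_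
  change ((starRingEnd ℂ) (w y) * w y + (starRingEnd ℂ) (u y) * (-κ * (p y * u y))).im = _
  have hyp : (starRingEnd ℂ) (u y) * (-κ * (p y * u y)) =
      -(((p y * ‖u y‖ ^ 2 : ℝ) : ℂ) * κ) := by
    rw [Complex.ofReal_mul, Complex.ofReal_pow, ← Complex.conj_mul']
    ring
  rw [hyp, Complex.conj_mul', ← Complex.ofReal_pow, Complex.add_im, Complex.ofReal_im,
    Complex.neg_im, Complex.im_ofReal_mul]
  ring

namespace IsMode

theorem cauchyData_ne_zero {q : ℝ → ℂ} (hm : IsMode L ω q u w)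
    (hq : MemLp q ⊤ (volume.restrict (Icc 0 L))) {x : ℝ} (hx : x ∈ Icc 0 L) :
    ¬(u x = 0 ∧ w x = 0) := fun h =>
  one_ne_zero (hm.one.symm.trans (hm.sol.initial_eq_zero hq hx h.1 h.2).1)

theorem hasDerivWithinAt {q : ℝ → ℂ} (hm : IsMode L ω q u w) {x : ℝ} (hx : x ∈ Icc 0 L) :
    HasDerivWithinAt u (w x) (Icc 0 L) x :=
  hm.sol.fst.hasDerivWithinAt hm.sol.snd.continuousOn hx

theorem exists_ne_zero {q : ℝ → ℂ} (hm : IsMode L ω q u w)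
    (hq : MemLp q ⊤ (volume.restrict (Icc 0 L))) {a b : ℝ} (ha : 0 ≤ a) (hab : a < b)
    (hb : b ≤ L) : ∃ x ∈ Icc a b, u x ≠ 0 := by
  by_contra! h
  have hsub : Icc a b ⊆ Icc 0 L := Icc_subset_Icc ha hb
  have haI : a ∈ Icc a b := left_mem_Icc.2 hab.le
  refine hm.cauchyData_ne_zero hq (hsub haI) ⟨h a haI, ?_⟩
  refine (uniqueDiffOn_Icc hab a haI).eq_deriv _ ((hm.hasDerivWithinAt (hsub haI)).mono hsub) ?_
  exact (hasDerivWithinAt_const a _ (0 : ℂ)).congr h (h a haI)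

variable (hm : IsMode L ω (fun x => (p x : ℂ)) u w)
  (hp : MemLp (fun x => (p x : ℂ)) ⊤ (volume.restrict (Icc 0 L)))
  (hpos : ∀ᵐ x ∂volume.restrict (Icc 0 L), 0 < p x)
  (hsym : ∀ᵐ x ∂volume.restrict (Icc 0 L), p (L - x) = p x)
include hm hp

include hpos in
theorem integral_mul_norm_sq_pos {a b : ℝ} (ha : 0 ≤ a) (hab : a < b) (hb : b ≤ L) :
    0 < ∫ y in a..b, p y * ‖u y‖ ^ 2 := by
  have hsub : Icc a b ⊆ Icc 0 L := Icc_subset_Icc ha hb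
  have hu := hm.sol.fst.continuousOn.mono hsub
  have hint : IntegrableOn (fun y => p y * ‖u y‖ ^ 2) (Icc a b) :=
    IntegrableOn.mul_continuousOn ((hp.re.integrable le_top).mono_measure
      (Measure.restrict_mono_set _ hsub)) (hu.norm.pow 2) isCompact_Icc
  have hpos' := ae_restrict_of_ae_restrict_of_subset hsub hpos
  have hnn : 0 ≤ᵐ[volume.restrict (Icc a b)] fun y => p y * ‖u y‖ ^ 2 := by
    filter_upwards [hpos'] with y hy using by positivity
  rw [intervalIntegral.integral_of_le hab.le, ← integral_Icc_eq_integral_Ioc]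
  refine (integral_nonneg_of_ae hnn).lt_of_ne' fun h0 => ?_
  obtain ⟨x, hx, hux⟩ := hm.exists_ne_zero hp ha hab hb
  refine hux (Measure.eqOn_Icc_of_ae_eq volume hab.ne ?_ hu continuousOn_const hx)
  filter_upwards [hpos', (integral_eq_zero_iff_of_nonneg_ae hnn hint).1 h0] with y hy hy0
  exact norm_eq_zero.1 (eq_zero_of_pow_eq_zero ((mul_eq_zero.1 hy0).resolve_left hy.ne'))

include hpos in
theorem im_neg (hL : 0 < L) (hre : ω.re ≠ 0) : ω.im < 0 := by
  have hflux := hm.sol.flux_sub (left_mem_Icc.2 hL.le) (right_mem_Icc.2 hL.le)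
  have hQ := hm.integral_mul_norm_sq_pos hp hpos le_rfl hL le_rfl
  set Q := ∫ y in (0 : ℝ)..L, p y * ‖u y‖ ^ 2
  rw [hm.left, hm.right, hm.one, im_conj_mul, im_conj_mul] at hflux
  simp only [Complex.mul_re, Complex.mul_im, Complex.I_re, Complex.I_im, Complex.neg_re,
    Complex.neg_im, Complex.one_re, Complex.one_im, pow_two] at hflux
  have hbalance : (u L).re ^ 2 + (u L).im ^ 2 + 1 + 2 * ω.im * Q = 0 :=
    (mul_eq_zero.1 (by linear_combination hflux)).resolve_left hre
  by_contra! h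
  have : 0 ≤ 2 * ω.im * Q := by positivity
  nlinarith [sq_nonneg (u L).re, sq_nonneg (u L).im]

include hsym

theorem reflect_eq {x : ℝ} (hx : x ∈ Icc 0 L) :
    u (L - x) = u L * u x ∧ -w (L - x) = u L * w x := by
  have h := (hm.sol.reflect (hsym.mono fun x hx => by rw [hx])).unique
    (hm.sol.const_mul (u L)) hp (by rw [sub_zero, hm.one, mul_one])
    (by rw [sub_zero, hm.right, hm.left]; ring)
  exact ⟨h.1 hx, h.2 hx⟩

theorem sq_right_eq_one (hL : 0 ≤ L) : u L ^ 2 = 1 := by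
  have h := (hm.reflect_eq hp hsym (right_mem_Icc.2 hL)).1
  rw [sub_self, hm.one] at h
  rw [pow_two, ← h]

theorem sq_reflect {x : ℝ} (hx : x ∈ Icc 0 L) : u (L - x) ^ 2 = u x ^ 2 := by
  rw [(hm.reflect_eq hp hsym hx).1, mul_pow,
    hm.sq_right_eq_one hp hsym (hx.1.trans hx.2), one_mul]

theorem flux_midpoint (hL : 0 ≤ L) : (starRingEnd ℂ) (u (L / 2)) * w (L / 2) = 0 := by
  obtain ⟨hu, hw⟩ := hm.reflect_eq hp hsym (x := L / 2) ⟨by linarith, by linarith⟩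
  rw [sub_half] at hu hw
  rcases sq_eq_one_iff.1 (hm.sq_right_eq_one hp hsym hL) with h | h
  · rw [h, one_mul] at hw
    rw [self_eq_neg.1 hw.symm, mul_zero]
  · rw [h, neg_one_mul] at hu
    rw [self_eq_neg.1 hu, map_zero, zero_mul]

include hpos in
theorem flux_ne_zero (hre : ω.re ≠ 0) {x : ℝ} (hx : x ∈ Ioc (L / 2) L) :
    ((starRingEnd ℂ) (u x) * w x).im ≠ 0 := by
  have hL : 0 < L := by linarith [hx.1, hx.2]
  have hsub := hm.sol.flux_sub (a := L / 2) (b := x) ⟨by linarith, by linarith⟩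
    ⟨by linarith [hx.1], hx.2⟩
  rw [hm.flux_midpoint hp hsym hL.le, Complex.zero_im, sub_zero] at hsub
  rw [hsub, pow_two, Complex.mul_im, mul_comm ω.im, ← two_mul]
  exact mul_ne_zero
    (neg_ne_zero.2 (mul_ne_zero two_ne_zero (mul_ne_zero hre (hm.im_neg hp hpos hL hre).ne)))
    (hm.integral_mul_norm_sq_pos hp hpos (by linarith) hx.1 hx.2).ne'

include hpos in
theorem finite_re_const_mul_eq_zero (hL : 0 ≤ L) (hre : ω.re ≠ 0) {c : ℂ} (hc : c ≠ 0) :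
    {x ∈ Icc (L / 2) L | (c * u x).re = 0}.Finite := by
  have hsub : Icc (L / 2) L ⊆ Icc 0 L := Icc_subset_Icc (by linarith) le_rfl
  refine finite_re_eq_zero (v' := fun x => c * w x)
    (fun x hx => ((hm.hasDerivWithinAt (hsub hx)).mono hsub).const_mul c) (fun x hx => ?_) ?_
  · have hflux : (starRingEnd ℂ) (c * u x) * (c * w x) =
        ((‖c‖ ^ 2 : ℝ) : ℂ) * ((starRingEnd ℂ) (u x) * w x) := by
      rw [map_mul, Complex.ofReal_pow]
      linear_combination (starRingEnd ℂ) (u x) * w x * Complex.conj_mul' c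
    rw [hflux, Complex.im_ofReal_mul]
    exact mul_ne_zero (pow_ne_zero 2 (norm_ne_zero_iff.2 hc))
      (hm.flux_ne_zero hp hpos hsym hre hx)
  · simpa only [mul_eq_zero, hc, false_or] using
      hm.cauchyData_ne_zero hp (hsub (left_mem_Icc.2 (by linarith)))

include hpos in
theorem finite_im_const_mul_sq_eq_zero (hre : ω.re ≠ 0) {C : ℂ} (hC : C ≠ 0) :
    {x ∈ Icc 0 L | (C * u x ^ 2).im = 0}.Finite := by
  rcases lt_or_ge L 0 with hL | hL
  · simp [Icc_eq_empty hL.not_ge]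
  obtain ⟨c, rfl⟩ := IsAlgClosed.exists_pow_nat_eq C two_pos
  have hc : c ≠ 0 := by rintro rfl; simp at hC
  have hright : {x ∈ Icc (L / 2) L | (c ^ 2 * u x ^ 2).im = 0}.Finite := by
    refine ((hm.finite_re_const_mul_eq_zero hp hpos hsym hL hre hc).union
      (hm.finite_re_const_mul_eq_zero hp hpos hsym hL hre
        (mul_ne_zero Complex.I_ne_zero hc))).subset fun x ⟨hx, hx0⟩ => ?_
    have hzero : (c * u x).re * (c * u x).im = 0 := by
      rw [← mul_pow, pow_two, Complex.mul_im] at hx0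
      linarith
    refine (mul_eq_zero.1 hzero).imp (fun h => ⟨hx, h⟩) fun h => ⟨hx, ?_⟩
    rw [mul_assoc, Complex.I_mul_re, h, neg_zero]
  refine (hright.union (hright.image fun x => L - x)).subset fun x ⟨hx, hx0⟩ => ?_
  rcases le_total (L / 2) x with h | h
  · exact .inl ⟨⟨h, hx.2⟩, hx0⟩
  · exact .inr ⟨L - x, ⟨⟨by linarith, by linarith [hx.1]⟩,
      by rwa [hm.sq_reflect hp hsym hx]⟩, sub_sub_cancel L x⟩

end IsMode

theorem not_eventually_charFun_eq_zero (hL : 0 < L)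
    (hp : MemLp (fun x => (p x : ℂ)) ⊤ (volume.restrict (Icc 0 L)))
    (hpos : ∀ᵐ x ∂volume.restrict (Icc 0 L), 0 < p x) (ω₀ : ℂ) :
    ¬∀ᶠ z in 𝓝 ω₀, charFun hL.le (hp.toLp _) z = 0 := fun h => by
  have hanalytic : AnalyticOnNhd ℂ (charFun hL.le (hp.toLp _)) univ := fun z _ =>
    (differentiable_charFun hL.le _).analyticAt z
  have hzero := hanalytic.eqOn_zero_of_preconnected_of_eventuallyEq_zero isPreconnected_univ
    (mem_univ ω₀) h
  obtain ⟨u, w, hm⟩ := (charFun_eq_zero_iff hL.le _).1 (hzero (mem_univ (1 + Complex.I)))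
  exact absurd ((hm.congr_ae hp.coeFn_toLp).im_neg hp hpos hL (by simp)) (by simp)

end RealDensity

/-! ### Splitting of a multiple zero -/

-- Otherwise `1 / G` is holomorphic on the ball and violates the maximum modulus principle.
theorem exists_zero_of_norm_sub_le {G P : ℂ → ℂ} {s₀ : ℂ} {r m : ℝ} (hr : 0 < r) (hm : 0 < m)
    (hG : Differentiable ℂ G) (hP : ∀ z ∈ Metric.sphere s₀ r, m ≤ ‖P z‖) (hP0 : P s₀ = 0)
    (hGP : ∀ z ∈ Metric.closedBall s₀ r, ‖G z - P z‖ ≤ m / 3) :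
    ∃ z ∈ Metric.closedBall s₀ r, G z = 0 := by
  by_contra! hne
  have hbd : ∀ z ∈ frontier (Metric.ball s₀ r), ‖(G z)⁻¹‖ ≤ (2 * m / 3)⁻¹ := by
    intro z hz
    rw [frontier_ball s₀ hr.ne'] at hz
    rw [norm_inv]
    refine inv_anti₀ (by positivity) ?_
    have hsub := norm_sub_norm_le (P z) (G z)
    rw [norm_sub_rev] at hsub
    linarith [hGP z (Metric.sphere_subset_closedBall hz), hP z hz]
  have hle := Complex.norm_le_of_forall_mem_frontier_norm_le Metric.isBounded_ball
    (hG.diffContOnCl.inv (by rwa [closure_ball s₀ hr.ne'])) hbd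
    (subset_closure (Metric.mem_ball_self hr))
  have hs₀ := Metric.mem_closedBall_self (x := s₀) hr.le
  have hcentre := hGP s₀ hs₀
  rw [hP0, sub_zero] at hcentre
  rw [Pi.inv_apply, norm_inv, inv_le_inv₀ (norm_pos_iff.2 (hne s₀ hs₀)) (by positivity)] at hle
  linarith

theorem eventually_exists_zero_of_tendstoLocallyUniformly {ι : Type*} {l : Filter ι}
    {G : ι → ℂ → ℂ} {P : ℂ → ℂ} {s₀ : ℂ} (hG : ∀ i, Differentiable ℂ (G i)) (hP : Continuous P)
    (hP0 : P s₀ = 0) (hne : ∀ᶠ s in 𝓝[≠] s₀, P s ≠ 0) (hGP : TendstoLocallyUniformly G P l)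
    {U : Set ℂ} (hU : U ∈ 𝓝 s₀) : ∀ᶠ i in l, ∃ s ∈ U, G i s = 0 := by
  obtain ⟨r, hr, hrU⟩ := Metric.nhds_basis_closedBall.mem_iff.1
    (inter_mem hU (eventually_nhdsWithin_iff.1 hne))
  obtain ⟨z, hz, hmin⟩ := (isCompact_sphere s₀ r).exists_isMinOn
    (NormedSpace.sphere_nonempty.2 hr.le) hP.norm.continuousOn
  have hm : 0 < ‖P z‖ := norm_pos_iff.2
    ((hrU (Metric.sphere_subset_closedBall hz)).2 (Metric.ne_of_mem_sphere hz hr.ne'))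
  have hunif := (tendstoLocallyUniformlyOn_iff_tendstoUniformlyOn_of_compact
    (isCompact_closedBall s₀ r)).1 hGP.tendstoLocallyUniformlyOn
  filter_upwards [Metric.tendstoUniformlyOn_iff.1 hunif _ (div_pos hm three_pos)] with i hi
  obtain ⟨s, hs, hs0⟩ := exists_zero_of_norm_sub_le hr hm (hG i) hmin hP0 fun s hs => by
    rw [← dist_eq_norm, dist_comm]
    exact (hi s hs).le
  exact ⟨s, (hrU hs).1, hs0⟩

theorem exists_pow_eq_im_pos {z : ℂ} (hz : 0 < z.im) {k : ℕ} (hk : k ≠ 0) :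
    ∃ s : ℂ, s ^ k = z ∧ 0 < s.im := by
  have hz0 : z ≠ 0 := by rintro rfl; simp at hz
  refine ⟨Complex.exp (Complex.log z / k), ?_, ?_⟩
  · rw [← Complex.exp_nat_mul, mul_div_cancel₀ _ (Nat.cast_ne_zero.2 hk), Complex.exp_log hz0]
  · have harg0 : 0 < z.arg := (Complex.arg_nonneg_iff.2 hz.le).lt_of_ne fun h =>
      hz.ne' (Complex.arg_eq_zero_iff.1 h.symm).2
    have hargpi : z.arg < Real.pi := (Complex.arg_le_pi z).lt_of_ne fun h =>
      hz.ne' (Complex.arg_eq_pi_iff.1 h).2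
    rw [Complex.exp_im, Complex.div_natCast_im, Complex.log_im]
    refine mul_pos (Real.exp_pos _) (Real.sin_pos_of_pos_of_lt_pi (by positivity) ?_)
    exact (div_le_self harg0.le (Nat.one_le_cast.2 (Nat.one_le_iff_ne_zero.2 hk))).trans_lt hargpi

section Splitting

variable {F : ℂ × ℂ → ℂ} {g : ℂ → ℂ} {ω₀ A : ℂ} {k : ℕ}

theorem tendsto_slope_snd (hF : ContDiff ℂ 1 F) (hA : HasDerivAt (fun t => F (ω₀, t)) A 0) :
    Tendsto (fun p : ℂ × ℂ => (F p - F (p.1, 0)) / p.2) (𝓝 ω₀ ×ˢ 𝓝[≠] 0) (𝓝 A) := by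
  have hstrict : HasStrictFDerivAt F (fderiv ℂ F (ω₀, 0)) (ω₀, 0) :=
    hF.contDiffAt.hasStrictFDerivAt one_ne_zero
  have hfderiv : fderiv ℂ F (ω₀, 0) (0, 1) = A :=
    (hstrict.hasFDerivAt.comp_hasDerivAt (0 : ℂ)
      ((hasDerivAt_const 0 ω₀).prodMk (hasDerivAt_id 0))).unique hA
  have hdiag : Tendsto (fun p : ℂ × ℂ => (p, (p.1, (0 : ℂ)))) (𝓝 ω₀ ×ˢ 𝓝[≠] 0)
      (𝓝 ((ω₀, 0), (ω₀, 0))) :=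
    (Continuous.tendsto' (by fun_prop) (ω₀, 0) _ rfl).mono_left
      ((Filter.prod_mono_right _ nhdsWithin_le_nhds).trans nhds_prod_eq.ge)
  have hne : ∀ᶠ p : ℂ × ℂ in 𝓝 ω₀ ×ˢ 𝓝[≠] 0, p.2 ≠ 0 :=
    tendsto_snd.eventually self_mem_nhdsWithin
  have hlin : (fun p : ℂ × ℂ => F p - F (p.1, 0) - p.2 * A) =o[𝓝 ω₀ ×ˢ 𝓝[≠] 0] Prod.snd := by
    have hsub (p : ℂ × ℂ) : p - (p.1, 0) = p.2 • ((0 : ℂ), (1 : ℂ)) := by ext <;> simp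
    have h := hstrict.isLittleO.comp_tendsto hdiag
    simp only [Function.comp_def, hsub, map_smul, hfderiv, smul_eq_mul] at h
    exact h.trans_isBigO (.of_bound 1 (.of_forall fun p => by simp [Prod.norm_def]))
  refine (zero_add A ▸ hlin.tendsto_div_nhds_zero.add_const A).congr' ?_
  filter_upwards [hne] with p hp
  rw [sub_div, mul_div_cancel_left₀ _ hp, sub_add_cancel]

theorem tendsto_rescaled (hF : ContDiff ℂ 1 F) (hA : HasDerivAt (fun t => F (ω₀, t)) A 0)
    (hk : k ≠ 0) (hg : ContinuousAt g ω₀)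
    (hFg : ∀ᶠ z in 𝓝 ω₀, F (z, 0) = (z - ω₀) ^ k * g z) (s₁ : ℂ) :
    Tendsto (fun p : ℝ × ℂ => F (ω₀ + p.1 * p.2, (p.1 : ℂ) ^ k) / (p.1 : ℂ) ^ k)
      (𝓝[>] 0 ×ˢ 𝓝 s₁) (𝓝 (A + s₁ ^ k * g ω₀)) := by
  have hpos : ∀ᶠ p : ℝ × ℂ in 𝓝[>] 0 ×ˢ 𝓝 s₁, 0 < p.1 :=
    tendsto_fst.eventually self_mem_nhdsWithin
  have hle : 𝓝[>] (0 : ℝ) ×ˢ 𝓝 s₁ ≤ 𝓝 (0, s₁) :=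
    (Filter.prod_mono_left _ nhdsWithin_le_nhds).trans nhds_prod_eq.ge
  have hz : Tendsto (fun p : ℝ × ℂ => ω₀ + p.1 * p.2) (𝓝[>] 0 ×ˢ 𝓝 s₁) (𝓝 ω₀) :=
    (Continuous.tendsto' (by fun_prop) (0, s₁) _ (by simp)).mono_left hle
  have ht : Tendsto (fun p : ℝ × ℂ => (p.1 : ℂ) ^ k) (𝓝[>] 0 ×ˢ 𝓝 s₁) (𝓝[≠] 0) := by
    refine tendsto_nhdsWithin_iff.2
      ⟨(Continuous.tendsto' (by fun_prop) (0, s₁) _ (by simp [hk])).mono_left hle, ?_⟩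
    filter_upwards [hpos] with p hp using pow_ne_zero k (Complex.ofReal_ne_zero.2 hp.ne')
  have hs : Tendsto (fun p : ℝ × ℂ => p.2 ^ k) (𝓝[>] 0 ×ˢ 𝓝 s₁) (𝓝 (s₁ ^ k)) :=
    (Continuous.tendsto' (by fun_prop) (0, s₁) _ rfl).mono_left hle
  refine (((tendsto_slope_snd hF hA).comp (hz.prodMk ht)).add
    (hs.mul (hg.tendsto.comp hz))).congr' ?_
  filter_upwards [hpos, hz.eventually hFg] with p hp hpg
  have hp0 : (p.1 : ℂ) ≠ 0 := Complex.ofReal_ne_zero.2 hp.ne'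
  simp only [Function.comp_apply, hpg, add_sub_cancel_left]
  field_simp
  ring

-- As `τ → 0⁺`, the rescaled functions `s ↦ F (ω₀ + τ s, τ ^ k) / τ ^ k` converge locally uniformly
-- to `A + g(ω₀) s ^ k`.
theorem eventually_exists_rescaled_zero (hF : ContDiff ℂ 1 F)
    (hA : HasDerivAt (fun t => F (ω₀, t)) A 0) (hk : k ≠ 0) (hg : ContinuousAt g ω₀)
    (hg0 : g ω₀ ≠ 0) (hFg : ∀ᶠ z in 𝓝 ω₀, F (z, 0) = (z - ω₀) ^ k * g z) {s₀ : ℂ} (hs₀ : s₀ ≠ 0)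
    (hs₀k : A + s₀ ^ k * g ω₀ = 0) {U : Set ℂ} (hU : U ∈ 𝓝 s₀) :
    ∀ᶠ τ : ℝ in 𝓝[>] 0, ∃ s ∈ U, F (ω₀ + τ * s, (τ : ℂ) ^ k) = 0 := by
  let G (τ : ℝ) (s : ℂ) : ℂ := F (ω₀ + τ * s, (τ : ℂ) ^ k) / (τ : ℂ) ^ k
  let P (s : ℂ) : ℂ := A + s ^ k * g ω₀
  have hP : Continuous P := by fun_prop
  have hP_ne : ∀ᶠ s in 𝓝[≠] s₀, P s ≠ 0 :=
    (((hasDerivAt_pow k s₀).mul_const (g ω₀)).const_add A).eventually_ne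
      (mul_ne_zero (mul_ne_zero (Nat.cast_ne_zero.2 hk) (pow_ne_zero _ hs₀)) hg0)
  have hG (τ : ℝ) : Differentiable ℂ (G τ) :=
    ((hF.differentiable one_ne_zero).comp (by fun_prop)).div_const _
  have hGP : TendstoLocallyUniformly G P (𝓝[>] 0) :=
    tendstoLocallyUniformly_iff_forall_tendsto.2 fun s₁ =>
      ((hP.tendsto s₁).comp tendsto_snd).prodMk_nhds
        (tendsto_rescaled hF hA hk hg hFg s₁) |>.mono_right (nhds_le_uniformity _)
  filter_upwards [eventually_exists_zero_of_tendstoLocallyUniformly hG hP hs₀k hP_ne hGP hU,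
    self_mem_nhdsWithin] with τ ⟨s, hs, hs0⟩ hτ
  exact ⟨s, hs, (div_eq_zero_iff.1 hs0).resolve_right
    (pow_ne_zero k (Complex.ofReal_ne_zero.2 (ne_of_gt hτ)))⟩

theorem tendsto_rpow_inv_nhdsGT_zero (hk : k ≠ 0) :
    Tendsto (fun t : ℝ => t ^ (k⁻¹ : ℝ)) (𝓝[>] 0) (𝓝[>] 0) := by
  have hk' : (k⁻¹ : ℝ) ≠ 0 := inv_ne_zero (Nat.cast_ne_zero.2 hk)
  refine tendsto_nhdsWithin_iff.2 ⟨((Real.continuous_rpow_const (by positivity)).tendsto' 0 0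
    (Real.zero_rpow hk')).mono_left nhdsWithin_le_nhds, ?_⟩
  filter_upwards [self_mem_nhdsWithin] with t ht using Real.rpow_pos_of_pos ht _

theorem eventually_exists_zero_im_lt (hF : ContDiff ℂ 1 F)
    (hA : HasDerivAt (fun t => F (ω₀, t)) A 0) (hk : k ≠ 0) (hg : ContinuousAt g ω₀)
    (hg0 : g ω₀ ≠ 0) (hFg : ∀ᶠ z in 𝓝 ω₀, F (z, 0) = (z - ω₀) ^ k * g z)
    (him : 0 < (-A / g ω₀).im) {V : Set ℂ} (hV : V ∈ 𝓝 ω₀) :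
    ∀ᶠ t : ℝ in 𝓝[>] 0, ∃ z ∈ V, ω₀.im < z.im ∧ F (z, t) = 0 := by
  obtain ⟨s₀, hs₀, hs₀_im⟩ := exists_pow_eq_im_pos him hk
  have hs₀_ne : s₀ ≠ 0 := by rintro rfl; simp at hs₀_im
  have hs₀_root : A + s₀ ^ k * g ω₀ = 0 := by
    rw [hs₀, div_mul_cancel₀ _ hg0, add_neg_cancel]
  have hnear : ∀ᶠ p : ℝ × ℂ in 𝓝[>] 0 ×ˢ 𝓝 s₀, ω₀ + p.1 * p.2 ∈ V := by
    refine (Continuous.tendsto' (f := fun p : ℝ × ℂ => ω₀ + p.1 * p.2) (by fun_prop) (0, s₀) _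
      (by simp)).mono_left ?_ |>.eventually hV
    exact (Filter.prod_mono_left _ nhdsWithin_le_nhds).trans nhds_prod_eq.ge
  obtain ⟨T, hT, U, hU, hTU⟩ := eventually_prod_iff.1 hnear
  have him_pos : ∀ᶠ s : ℂ in 𝓝 s₀, 0 < s.im :=
    Complex.continuous_im.continuousAt.eventually (lt_mem_nhds hs₀_im)
  have hsplit : ∀ᶠ τ : ℝ in 𝓝[>] 0, ∃ z ∈ V, ω₀.im < z.im ∧ F (z, (τ : ℂ) ^ k) = 0 := by
    filter_upwards [eventually_exists_rescaled_zero hF hA hk hg hg0 hFg hs₀_ne hs₀_root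
      (hU.and him_pos), hT, self_mem_nhdsWithin] with τ ⟨s, ⟨hsU, hs_im⟩, hs0⟩ hτT hτ
    refine ⟨_, hTU hτT hsU, ?_, hs0⟩
    rw [Complex.add_im, Complex.im_ofReal_mul]
    exact lt_add_of_pos_right _ (mul_pos hτ hs_im)
  filter_upwards [(tendsto_rpow_inv_nhdsGT_zero hk).eventually hsplit, self_mem_nhdsWithin]
    with t ht ht0
  rwa [← Complex.ofReal_pow, Real.rpow_inv_natCast_pow (le_of_lt ht0) hk] at ht

end Splitting

/-! ### Competing indices -/

/-- The index with square `(1 - t) n² + t m²`. These indices, for `t ∈ [0, 1]`, form the path from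
`n` to `m` along which the coefficient of the equation is affine in `t`. -/
def sqInterp (n m : ℝ → ℝ) (t x : ℝ) : ℝ := √((1 - t) * n x ^ 2 + t * m x ^ 2)

section SqInterp

variable {L a b t : ℝ} {n m : ℝ → ℝ}

theorem sqInterp_sq (ht : t ∈ Icc 0 1) (x : ℝ) :
    sqInterp n m t x ^ 2 = n x ^ 2 + t * (m x ^ 2 - n x ^ 2) := by
  have := sub_nonneg.2 ht.2
  have := ht.1
  rw [sqInterp, Real.sq_sqrt (by positivity)]
  ring

theorem sqInterp_mem_Icc (ha : 0 ≤ a) (ht : t ∈ Icc 0 1) {x : ℝ} (hn : n x ∈ Icc a b)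
    (hm : m x ∈ Icc a b) : sqInterp n m t x ∈ Icc a b := by
  have hb : 0 ≤ b := ha.trans (hn.1.trans hn.2)
  have hsq {r : ℝ} (hr : r ∈ Icc a b) : r ^ 2 ∈ Icc (a ^ 2) (b ^ 2) :=
    ⟨pow_le_pow_left₀ ha hr.1 2, pow_le_pow_left₀ (ha.trans hr.1) hr.2 2⟩
  have hmem := convex_Icc (a ^ 2) (b ^ 2) (hsq hn) (hsq hm) (sub_nonneg.2 ht.2) ht.1
    (sub_add_cancel 1 t)
  exact ⟨Real.le_sqrt_of_sq_le hmem.1, Real.sqrt_le_iff.2 ⟨hb, hmem.2⟩⟩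

theorem abs_sqInterp_sub_le (ha : 0 < a) (ht : t ∈ Icc 0 1) {x : ℝ} (hn : n x ∈ Icc a b)
    (hm : m x ∈ Icc a b) : |sqInterp n m t x - n x| ≤ t * (b ^ 2 - a ^ 2) / a := by
  have hI := sqInterp_mem_Icc ha.le ht hn hm
  have hsum : a ≤ |sqInterp n m t x + n x| :=
    (by linarith [hI.1, hn.1] : a ≤ sqInterp n m t x + n x).trans (le_abs_self _)
  have hdiff : |m x ^ 2 - n x ^ 2| ≤ b ^ 2 - a ^ 2 := by
    have hn0 := ha.le.trans hn.1
    have hm0 := ha.le.trans hm.1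
    refine abs_sub_le_of_le_of_le ?_ ?_ ?_ ?_ <;> gcongr
    exacts [hm.1, hm.2, hn.1, hn.2]
  rw [le_div_iff₀ ha]
  calc |sqInterp n m t x - n x| * a ≤ |sqInterp n m t x - n x| * |sqInterp n m t x + n x| := by
        gcongr
    _ = t * |m x ^ 2 - n x ^ 2| := by
        rw [← abs_mul, ← abs_of_nonneg ht.1, ← abs_mul, abs_of_nonneg ht.1]
        congr 1
        linear_combination sqInterp_sq (n := n) (m := m) ht x
    _ ≤ t * (b ^ 2 - a ^ 2) := mul_le_mul_of_nonneg_left hdiff ht.1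

theorem sqInterp_eq_one {x : ℝ} (hn : n x = 1) (hm : m x = 1) : sqInterp n m t x = 1 := by
  rw [sqInterp, hn, hm, one_pow, mul_one, mul_one, sub_add_cancel, Real.sqrt_one]

theorem sqInterp_mem_admissibleSym (ha : 0 ≤ a) (ht : t ∈ Icc 0 1) (hn : n ∈ AdmissibleSym L a b)
    (hm : m ∈ AdmissibleSym L a b) : sqInterp n m t ∈ AdmissibleSym L a b := by
  refine ⟨⟨?_, ?_, ?_⟩, ?_⟩
  · exact (((hn.1.1.pow_const 2).const_mul (1 - t)).add ((hm.1.1.pow_const 2).const_mul t)).sqrt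
  · filter_upwards [hn.1.2.1, hm.1.2.1] with x hnx hmx hx using sqInterp_eq_one (hnx hx) (hmx hx)
  · filter_upwards [hn.1.2.2, hm.1.2.2] with x hnx hmx hx
      using sqInterp_mem_Icc ha ht (hnx hx) (hmx hx)
  · filter_upwards [hn.2, hm.2] with x hnx hmx
    rw [sqInterp, sqInterp, ← hnx, ← hmx]

theorem eLpNorm_sqInterp_sub_le (ha : 0 < a) (ht : t ∈ Icc 0 1) (hn : n ∈ Admissible L a b)
    (hm : m ∈ Admissible L a b) : eLpNorm (fun x => sqInterp n m t x - n x) ⊤ volume ≤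
      ENNReal.ofReal (|t * (b ^ 2 - a ^ 2) / a|) := by
  rw [eLpNorm_exponent_top]
  refine eLpNormEssSup_le_of_ae_bound ?_
  filter_upwards [hn.2.1, hm.2.1, hn.2.2, hm.2.2] with x hn_off hm_off hn_on hm_on
  by_cases hx : x ∈ Icc 0 L
  · exact (abs_sqInterp_sub_le ha ht (hn_on hx) (hm_on hx)).trans (le_abs_self _)
  · rw [sqInterp_eq_one (hn_off hx) (hm_off hx), hn_off hx, sub_self, norm_zero]
    exact abs_nonneg _

theorem toLp_sqIndex_sqInterp (ht : t ∈ Icc 0 1)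
    (hn : MemLp (sqIndex n) ⊤ (volume.restrict (Icc 0 L)))
    (hm : MemLp (sqIndex m) ⊤ (volume.restrict (Icc 0 L)))
    (hnm : MemLp (sqIndex (sqInterp n m t)) ⊤ (volume.restrict (Icc 0 L))) :
    hnm.toLp _ = hn.toLp _ + (t : ℂ) • (hm.sub hn).toLp _ := by
  rw [← MemLp.toLp_const_smul, ← MemLp.toLp_add]
  refine MemLp.toLp_congr _ _ (.of_forall fun x => ?_)
  simp [sqIndex, sqInterp_sq ht]

end SqInterp

/-- The point of `{a, b}` at which `r ↦ s r ^ 2` is largest on `[a, b]`, where `0 ≤ a`. In the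
degenerate case `s = 0` it is the given `r`. -/
def bangValue (a b s r : ℝ) : ℝ := if 0 < s then b else if s < 0 then a else r

section BangValue

variable {L a b r s : ℝ} {f n : ℝ → ℝ}

theorem bangValue_mem_Icc (hr : r ∈ Icc a b) : bangValue a b s r ∈ Icc a b := by
  have hab := hr.1.trans hr.2
  unfold bangValue
  split_ifs
  exacts [⟨hab, le_rfl⟩, ⟨le_rfl, hab⟩, hr]

theorem measurable_bangValue (a b : ℝ) : Measurable fun p : ℝ × ℝ => bangValue a b p.1 p.2 :=
  .ite (measurableSet_lt measurable_const measurable_fst) measurable_const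
    (.ite (measurableSet_lt measurable_fst measurable_const) measurable_const measurable_snd)

theorem bangValue_sq_sub_mul_nonneg (ha : 0 ≤ a) (hr : r ∈ Icc a b) :
    0 ≤ (bangValue a b s r ^ 2 - r ^ 2) * s := by
  have hr0 := ha.trans hr.1
  unfold bangValue
  split_ifs with hpos hneg
  · exact mul_nonneg (sub_nonneg.2 (pow_le_pow_left₀ hr0 hr.2 2)) hpos.le
  · exact mul_nonneg_of_nonpos_of_nonpos (sub_nonpos.2 (pow_le_pow_left₀ ha hr.1 2)) hneg.le
  · rw [sub_self, zero_mul]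

theorem eq_of_bangValue_sq_sub_mul_eq_zero (ha : 0 ≤ a) (hr : r ∈ Icc a b)
    (h : (bangValue a b s r ^ 2 - r ^ 2) * s = 0) : (0 < s → r = b) ∧ (s < 0 → r = a) := by
  have heq (hs : s ≠ 0) : bangValue a b s r = r :=
    (pow_left_inj₀ (ha.trans (bangValue_mem_Icc hr).1) (ha.trans hr.1) two_ne_zero).1
      (sub_eq_zero.1 ((mul_eq_zero.1 h).resolve_right hs))
  refine ⟨fun hs => ?_, fun hs => ?_⟩
  · rw [← heq hs.ne', bangValue, if_pos hs]
  · rw [← heq hs.ne, bangValue, if_neg hs.not_gt, if_pos hs]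

theorem exists_admissibleSym_eq_bangValue (hn : n ∈ AdmissibleSym L a b)
    (hf : ContinuousOn f (Icc 0 L)) (hfsym : ∀ x ∈ Icc 0 L, f (L - x) = f x) :
    ∃ m ∈ AdmissibleSym L a b, ∀ x ∈ Icc 0 L, m x = bangValue a b (f x) (n x) := by
  let s : ℝ → ℝ := (Icc 0 L).indicator f
  have hs {x : ℝ} (hx : x ∈ Icc 0 L) : s x = f x := indicator_of_mem hx f
  have hs0 {x : ℝ} (hx : x ∉ Icc 0 L) : s x = 0 := indicator_of_notMem hx f
  have hs_meas : AEMeasurable s :=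
    (aemeasurable_indicator_iff measurableSet_Icc).2 (hf.aemeasurable measurableSet_Icc)
  have hs_sym (x : ℝ) : s (L - x) = s x := by
    have hiff : L - x ∈ Icc 0 L ↔ x ∈ Icc 0 L := by
      rw [mem_Icc, mem_Icc, sub_nonneg, sub_le_self_iff, and_comm]
    by_cases hx : x ∈ Icc 0 L
    · rw [hs hx, hs (hiff.2 hx), hfsym x hx]
    · rw [hs0 hx, hs0 (hiff.not.2 hx)]
  refine ⟨fun x => bangValue a b (s x) (n x), ⟨⟨?_, ?_, ?_⟩, ?_⟩, fun x hx =>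
    congrArg (bangValue a b · (n x)) (hs hx)⟩
  · exact (measurable_bangValue a b).comp_aemeasurable (hs_meas.prodMk hn.1.1)
  · filter_upwards [hn.1.2.1] with x hnx hx
    simp only [bangValue, hs0 hx, lt_irrefl, if_false, hnx hx]
  · filter_upwards [hn.1.2.2] with x hnx hx using bangValue_mem_Icc (hnx hx)
  · filter_upwards [hn.2] with x hnx
    rw [hs_sym, ← hnx]

end BangValue

/-! ### First-order optimality -/

section Optimality

variable {L a b ρ : ℝ} {n m : ℝ → ℝ} {ω : ℂ} {u w : ℝ → ℂ}

theorem width_lt_of_mem_res {z : ℂ} (hz : z ∈ Res L n) (hre : |z.re| ≤ ρ) (him : |z.im| < |ω.im|) :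
    width L ρ n < ENNReal.ofReal |ω.im| :=
  (iInf₂_le z ⟨hz, hre⟩).trans_lt
    ((ENNReal.ofReal_lt_ofReal_iff ((abs_nonneg _).trans_lt him)).2 him)

theorem IsMode.exists_charFun_eventuallyEq_pow_mul {p : ℝ → ℝ} (hL : 0 < L)
    (hp : MemLp (fun x => (p x : ℂ)) ⊤ (volume.restrict (Icc 0 L)))
    (hpos : ∀ᵐ x ∂volume.restrict (Icc 0 L), 0 < p x)
    (hmode : IsMode L ω (fun x => (p x : ℂ)) u w) :
    ∃ k ≠ 0, ∃ g : ℂ → ℂ, ContinuousAt g ω ∧ g ω ≠ 0 ∧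
      ∀ᶠ z in 𝓝 ω, charFun hL.le (hp.toLp _) z = (z - ω) ^ k * g z := by
  obtain ⟨k, g, hg, hg0, hkg⟩ := ((differentiable_charFun hL.le
    (hp.toLp _)).analyticAt ω).exists_eventuallyEq_pow_smul_nonzero_iff.2
      (not_eventually_charFun_eq_zero hL hp hpos ω)
  refine ⟨k, ?_, g, hg.continuousAt, hg0, hkg⟩
  rintro rfl
  have hω := (charFun_eq_zero_iff hL.le _).2 ⟨u, w, hmode.congr_ae hp.coeFn_toLp.symm⟩
  rw [hkg.self_of_nhds, pow_zero, one_smul] at hω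
  exact hg0 hω

theorem eventually_width_le_sqInterp (ha : 0 < a) (hn : IsLocallyOptimal L a b ρ n)
    (hm : m ∈ AdmissibleSym L a b) :
    ∀ᶠ t : ℝ in 𝓝[>] 0, width L ρ n ≤ width L ρ (sqInterp n m t) := by
  obtain ⟨hn, δ, hδ, hmin⟩ := hn
  have hlim : Tendsto (fun t : ℝ => |t * (b ^ 2 - a ^ 2) / a|) (𝓝[>] 0) (𝓝 0) :=
    (Continuous.tendsto' (by fun_prop) 0 _ (by simp)).mono_left nhdsWithin_le_nhds
  filter_upwards [hlim.eventually (gt_mem_nhds hδ), Ioc_mem_nhdsGT one_pos] with t htδ ht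
  have htI : t ∈ Icc 0 1 := Ioc_subset_Icc_self ht
  exact hmin _ (sqInterp_mem_admissibleSym ha.le htI hn hm)
    ((eLpNorm_sqInterp_sub_le ha htI hn.1 hm.1).trans_lt
      ((ENNReal.ofReal_lt_ofReal_iff hδ).2 htδ))

theorem IsMode.im_integral_sqIndex_sub (hL : 0 ≤ L) {q : ℝ → ℂ} (hmode : IsMode L ω q u w)
    (hn : MemLp (sqIndex n) ⊤ (volume.restrict (Icc 0 L)))
    (hm : MemLp (sqIndex m) ⊤ (volume.restrict (Icc 0 L))) (C : ℂ) :
    (C * ∫ x in 0..L, (sqIndex m x - sqIndex n x) * u x ^ 2).im =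
      ∫ x in 0..L, (m x ^ 2 - n x ^ 2) * (C * u x ^ 2).im := by
  have hint : IntegrableOn (fun x => (sqIndex m x - sqIndex n x) * u x ^ 2) (Icc 0 L) :=
    IntegrableOn.mul_continuousOn ((hm.sub hn).integrable le_top)
      (hmode.sol.fst.continuousOn.pow 2) isCompact_Icc
  rw [← intervalIntegral.integral_const_mul, ← Complex.imCLM_apply,
    ← Complex.imCLM.intervalIntegral_comp_comm
      (((intervalIntegrable_iff_integrableOn_Icc_of_le hL).2 hint).const_mul C)]
  refine intervalIntegral.integral_congr fun x _ => ?_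
  simp only [sqIndex, Complex.imCLM_apply]
  rw [mul_left_comm, ← Complex.ofReal_sub, Complex.im_ofReal_mul]

theorem IsMode.eventually_width_sqInterp_lt (hL : 0 < L) (ha : 0 ≤ a)
    (hn : n ∈ AdmissibleSym L a b) (hm : m ∈ AdmissibleSym L a b)
    (hmode : IsMode L ω (sqIndex n) u w) (huL : u L ≠ 0) (hρ : |ω.re| < ρ) (him : ω.im < 0)
    {k : ℕ} (hk : k ≠ 0) {g : ℂ → ℂ} (hg : ContinuousAt g ω) (hg0 : g ω ≠ 0)
    (hkg : ∀ᶠ z in 𝓝 ω,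
      charFun hL.le ((memLp_sqIndex hn.1).toLp _) z = (z - ω) ^ k * g z)
    (hpos : 0 < ∫ x in 0..L, (m x ^ 2 - n x ^ 2) * (ω ^ 2 / (u L * g ω) * u x ^ 2).im) :
    ∀ᶠ t : ℝ in 𝓝[>] 0, width L ρ (sqInterp n m t) < ENNReal.ofReal |ω.im| := by
  have hqn := memLp_sqIndex hn.1
  have hqm := memLp_sqIndex hm.1
  have hderiv := (hmode.congr_ae hqn.coeFn_toLp.symm).hasDerivAt_charFun hL.le huL
    ((hqm.sub hqn).toLp _)
  have hint : ∫ y in 0..L, (hqm.sub hqn).toLp _ y * u y ^ 2 =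
      ∫ y in 0..L, (sqIndex m y - sqIndex n y) * u y ^ 2 :=
    integral_congr_ae_Icc ((hqm.sub hqn).coeFn_toLp.mul .rfl) (right_mem_Icc.2 hL.le)
  rw [hint] at hderiv
  have hpath : ContDiff ℂ 1 fun p : ℂ × ℂ =>
      charFun hL.le (hqn.toLp _ + p.2 • (hqm.sub hqn).toLp _) p.1 :=
    (contDiff_charFun hL.le).comp
      (contDiff_fst.prodMk (contDiff_const.add (contDiff_snd.smul contDiff_const)))
  have hV : {z : ℂ | z.im < 0 ∧ |z.re| < ρ} ∈ 𝓝 ω :=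
    ((isOpen_lt Complex.continuous_im continuous_const).inter
      (isOpen_lt Complex.continuous_re.abs continuous_const)).mem_nhds ⟨him, hρ⟩
  filter_upwards [eventually_exists_zero_im_lt hpath hderiv hk hg hg0
    (by simpa only [zero_smul, add_zero] using hkg) (by
      rw [← hmode.im_integral_sqIndex_sub hL.le hqn hqm] at hpos
      convert hpos using 2
      field_simp) hV, Ioc_mem_nhdsGT one_pos] with t ⟨z, ⟨hz_im, hz_re⟩, hωz, hz⟩ ht
  have htI : t ∈ Icc 0 1 := Ioc_subset_Icc_self ht
  have hqt := memLp_sqIndex (sqInterp_mem_admissibleSym ha htI hn hm).1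
  have hz0 : z ≠ 0 := by rintro rfl; simp at hz_im
  refine width_lt_of_mem_res ((mem_res_iff_charFun_eq_zero hL.le hz0 hqt).2 ?_) hz_re.le ?_
  · rwa [toLp_sqIndex_sqInterp htI hqn hqm]
  · rw [abs_of_neg hz_im, abs_of_neg him]
    exact neg_lt_neg hωz

theorem ae_restrict_sq_pos (ha : 0 < a) (hn : n ∈ Admissible L a b) :
    ∀ᵐ x ∂volume.restrict (Icc 0 L), 0 < n x ^ 2 := by
  filter_upwards [(ae_restrict_iff' measurableSet_Icc).2 hn.2.2] with x hx
  exact pow_pos (ha.trans_le hx.1) 2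

theorem ae_restrict_sq_reflect (hn : n ∈ AdmissibleSym L a b) :
    ∀ᵐ x ∂volume.restrict (Icc 0 L), n (L - x) ^ 2 = n x ^ 2 :=
  ae_restrict_of_ae (hn.2.mono fun x hx => by rw [← hx])

theorem IsLocallyOptimal.exists_multiplier (hn : IsLocallyOptimal L a b ρ n) (hL : 0 < L)
    (ha : 0 < a) (hmode : IsMode L ω (sqIndex n) u w)
    (hω : ENNReal.ofReal |ω.im| = width L ρ n) (hρ : |ω.re| < ρ) (hre : ω.re ≠ 0) :
    ∃ C : ℂ, C ≠ 0 ∧ ∀ m ∈ AdmissibleSym L a b,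
      ∫ x in 0..L, (m x ^ 2 - n x ^ 2) * (C * u x ^ 2).im ≤ 0 := by
  have hq := memLp_sqIndex hn.1.1
  have hpos := ae_restrict_sq_pos ha hn.1.1
  have him := hmode.im_neg hq hpos hL hre
  have hω0 : ω ≠ 0 := by rintro rfl; exact hre rfl
  have huL : u L ≠ 0 := by
    refine pow_ne_zero_iff two_ne_zero |>.1 ?_
    rw [hmode.sq_right_eq_one hq (ae_restrict_sq_reflect hn.1) hL.le]
    exact one_ne_zero
  obtain ⟨k, hk, g, hg, hg0, hkg⟩ := hmode.exists_charFun_eventuallyEq_pow_mul hL hq hpos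
  refine ⟨ω ^ 2 / (u L * g ω), div_ne_zero (pow_ne_zero 2 hω0) (mul_ne_zero huL hg0),
    fun m hm => le_of_not_gt fun hlt => ?_⟩
  obtain ⟨t, hle, hlt⟩ := ((eventually_width_le_sqInterp ha hn hm).and
    (hmode.eventually_width_sqInterp_lt hL ha.le hn.1 hm huL hρ him hk hg hg0 hkg hlt)).exists
  exact (hω ▸ hlt).not_ge hle

theorem ae_eq_of_forall_integral_nonpos {f : ℝ → ℝ} (hL : 0 ≤ L) (ha : 0 ≤ a)
    (hn : n ∈ AdmissibleSym L a b) (hf : ContinuousOn f (Icc 0 L))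
    (hfsym : ∀ x ∈ Icc 0 L, f (L - x) = f x)
    (hopt : ∀ m ∈ AdmissibleSym L a b, ∫ x in 0..L, (m x ^ 2 - n x ^ 2) * f x ≤ 0) :
    ∀ᵐ x ∂volume.restrict (Icc 0 L), (0 < f x → n x = b) ∧ (f x < 0 → n x = a) := by
  obtain ⟨m, hm, hmf⟩ := exists_admissibleSym_eq_bangValue hn hf hfsym
  have hnI : ∀ᵐ x ∂volume.restrict (Icc 0 L), n x ∈ Icc a b :=
    (ae_restrict_iff' measurableSet_Icc).2 hn.1.2.2
  have hnn : 0 ≤ᵐ[volume.restrict (Icc 0 L)] fun x => (m x ^ 2 - n x ^ 2) * f x := by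
    filter_upwards [hnI, ae_restrict_mem measurableSet_Icc] with x hnx hx
    rw [hmf x hx]
    exact bangValue_sq_sub_mul_nonneg ha hnx
  have hsq : IntegrableOn (fun x => m x ^ 2 - n x ^ 2) (Icc 0 L) :=
    (((memLp_sqIndex hm.1).re.sub (memLp_sqIndex hn.1).re).integrable le_top :)
  have hle : ∫ x in Icc 0 L, (m x ^ 2 - n x ^ 2) * f x ≤ 0 := by
    rw [integral_Icc_eq_integral_Ioc, ← intervalIntegral.integral_of_le hL]
    exact hopt m hm
  have hzero := (integral_eq_zero_iff_of_nonneg_ae hnn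
    (hsq.mul_continuousOn hf isCompact_Icc)).1 (hle.antisymm (integral_nonneg_of_ae hnn))
  filter_upwards [hzero, hnI, ae_restrict_mem measurableSet_Icc] with x hx hnx hxL
  rw [hmf x hxL] at hx
  exact eq_of_bangValue_sq_sub_mul_eq_zero ha hnx hx

end Optimality

/-! ### Indices governed by a switching function with finitely many zeros -/

theorem exists_strictMono_partition {α : Type*} [LinearOrder α] {a b : α} (hab : a ≤ b) {S : Set α}
    (hS : S.Finite) : ∃ (N : ℕ) (x : Fin (N + 1) → α), StrictMono x ∧ x 0 = a ∧
      x (Fin.last N) = b ∧ ∀ j : Fin N, Ioo (x j.castSucc) (x j.succ) ⊆ Icc a b \ S := by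
  classical
  let T : Finset α := insert a (insert b {x ∈ hS.toFinset | x ∈ Icc a b})
  have hTI : ∀ x ∈ T, x ∈ Icc a b := by
    simp [T, hab]
  have ha : a ∈ T := by simp [T]
  have hb : b ∈ T := by simp [T]
  have hcard : T.card = T.card - 1 + 1 :=
    (Nat.sub_add_cancel (Finset.card_pos.2 ⟨a, ha⟩)).symm
  let e := T.orderEmbOfFin hcard
  have heT (i) : e i ∈ T := T.orderEmbOfFin_mem hcard i
  have hsurj : ∀ x ∈ T, ∃ i, e i = x := fun x hx =>
    (T.range_orderEmbOfFin hcard).ge hx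
  obtain ⟨i, hi⟩ := hsurj a ha
  obtain ⟨j, hj⟩ := hsurj b hb
  refine ⟨T.card - 1, e, e.strictMono, ?_, ?_, fun l y hy => ?_⟩
  · exact (hi ▸ e.monotone (Fin.zero_le i)).antisymm (hTI _ (heT 0)).1
  · exact (hTI _ (heT _)).2.antisymm (hj ▸ e.monotone (Fin.le_last j))
  · have hyI : y ∈ Icc a b := ⟨(hTI _ (heT _)).1.trans hy.1.le, hy.2.le.trans (hTI _ (heT _)).2⟩
    refine ⟨hyI, fun hyS => ?_⟩
    obtain ⟨i, rfl⟩ := hsurj y (by simp [T, hyS, hyI.1, hyI.2])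
    exact (Fin.castSucc_lt_iff_succ_le.1 (e.lt_iff_lt.1 hy.1)).not_gt (e.lt_iff_lt.1 hy.2)

section Switching

variable {L a b : ℝ} {f n : ℝ → ℝ} (hf : ContinuousOn f (Icc 0 L))
  (hfin : {x ∈ Icc 0 L | f x = 0}.Finite)
  (hn : ∀ᵐ x ∂volume.restrict (Icc 0 L), (0 < f x → n x = b) ∧ (f x < 0 → n x = a))

theorem exists_volume_eq_zero_of_eventually_ne {P : ℝ → Prop} {x c : ℝ}
    (hP : ∀ᶠ y in 𝓝[Icc 0 L] x, P y)
    (hc : ∀ᵐ y ∂volume.restrict (Icc 0 L), P y → n y ≠ c) :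
    ∃ ε > 0, volume {y | y ∈ Icc 0 L ∧ |y - x| < ε ∧ n y = c} = 0 := by
  obtain ⟨ε, hε, hεP⟩ := Metric.mem_nhdsWithin_iff.1 hP
  refine ⟨ε, hε, measure_mono_null ?_ ((ae_restrict_iff' measurableSet_Icc).1 hc)⟩
  rintro y ⟨hy, hyx, hyc⟩ h
  exact h hy (hεP ⟨hyx, hy⟩) hyc

include hf hfin hn

theorem finite_isTransitionPoint (hab : a ≠ b) : {x | IsTransitionPoint L a b n x}.Finite := by
  refine hfin.subset fun x ⟨hxL, hx⟩ => ⟨hxL, ?_⟩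
  by_contra hne
  rcases lt_or_gt_of_ne hne with hneg | hpos
  · obtain ⟨ε, hε, h0⟩ := exists_volume_eq_zero_of_eventually_ne
      ((hf x hxL).eventually (gt_mem_nhds hneg)) (hn.mono fun y hy hfy => (hy.2 hfy).trans_ne hab)
    exact (hx ε hε).1.ne' h0
  · obtain ⟨ε, hε, h0⟩ := exists_volume_eq_zero_of_eventually_ne
      ((hf x hxL).eventually (lt_mem_nhds hpos))
      (hn.mono fun y hy hfy => (hy.1 hfy).trans_ne hab.symm)
    exact (hx ε hε).2.ne' h0

theorem isStepFunction_of_finite_zeros (hL : 0 ≤ L) : IsStepFunction L a b n := by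
  obtain ⟨N, x, hx, hx0, hxN, hsub⟩ := exists_strictMono_partition hL hfin
  refine ⟨N, x, hx, hx0, hxN, fun j => ?_⟩
  have hfj : ContinuousOn f (Ioo (x j.castSucc) (x j.succ)) :=
    hf.mono fun y hy => (hsub j hy).1
  have hne (y) (hy : y ∈ Ioo (x j.castSucc) (x j.succ)) : f y ≠ 0 := fun h0 =>
    (hsub j hy).2 ⟨(hsub j hy).1, h0⟩
  have hn' := (ae_restrict_iff' measurableSet_Icc).1 hn
  by_cases hpos : ∀ y ∈ Ioo (x j.castSucc) (x j.succ), 0 < f y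
  · left
    filter_upwards [hn'] with y hy hyj using (hy (hsub j hyj).1).1 (hpos y hyj)
  · right
    push Not at hpos
    obtain ⟨z, hz, hz0⟩ := hpos
    filter_upwards [hn'] with y hy hyj
    refine (hy (hsub j hyj).1).2 (lt_of_not_ge fun hy0 => ?_)
    obtain ⟨v, hv, hv0⟩ := isPreconnected_Ioo.intermediate_value hz hyj hfj ⟨hz0, hy0⟩
    exact hne v hv hv0

end Switching

end ScatRes

end

theorem theorem6p5 (L nminus nplus ρ : ℝ) (hL : 0 < L)
    (hminus : 0 < nminus) (hplus : nminus < nplus)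
    (n : ℝ → ℝ) (hn : ScatRes.IsLocallyOptimal L nminus nplus ρ n)
    (ω : ℂ) (hω : ω ∈ ScatRes.Res L n)
    (hopt : ENNReal.ofReal |ω.im| = ScatRes.width L ρ n)
    (hρ : |ω.re| < ρ) (hre : ω.re ≠ 0) :
    {x : ℝ | ScatRes.IsTransitionPoint L nminus nplus n x}.Finite ∧
      ScatRes.IsStepFunction L nminus nplus n := by
  have hq := ScatRes.memLp_sqIndex hn.1.1
  have hpos := ScatRes.ae_restrict_sq_pos hminus hn.1.1
  have hsym := ScatRes.ae_restrict_sq_reflect hn.1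
  obtain ⟨u, w, hmode⟩ := ScatRes.exists_isMode_of_mem_res hL.le hq hω
  obtain ⟨C, hC, hvar⟩ := hn.exists_multiplier hL hminus hmode hopt hρ hre
  have hcont : ContinuousOn (fun x => (C * u x ^ 2).im) (Set.Icc 0 L) :=
    Complex.continuous_im.comp_continuousOn
      (continuousOn_const.mul (hmode.sol.fst.continuousOn.pow 2))
  have hfin := hmode.finite_im_const_mul_sq_eq_zero hq hpos hsym hre hC
  have hbang := ScatRes.ae_eq_of_forall_integral_nonpos hL.le hminus.le hn.1 hcont
    (fun x hx => by rw [hmode.sq_reflect hq hsym hx]) hvar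
  exact ⟨ScatRes.finite_isTransitionPoint hcont hfin hbang hplus.ne,
    ScatRes.isStepFunction_of_finite_zeros hcont hfin hbang hL.le⟩
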